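/- **The model (GSHM).** Fix $\alpha,\eta\in(0,1)$, $r\in(0,1/2]$, $\xi\in[0,1]$, and $\rho^{(p)}_R,\rho^{(p)}_B\in(0,1]$, $\rho^{(u)}_R,\rho^{(u)}_B\in[0,1]$. A bipartite multigraph between members and groups, each colored red ($R$) or blue ($B$), grows in discrete time. At time $t=2$ it consists of a red member joined to a red group and a blue member joined to a blue group. In each time step exactly one edge is added, as follows. * With probability $\alpha$ a new member $m$ arrives, red with probability $r$ and blue otherwise; with probability $1-\alpha$ an existing member $m$ is picked with probability proportional to its degree. * With probability $\eta$ the member $m$ creates a new group of its own color (and is joined to it). * With probability $1-\eta$ the member $m$ joins an existing group by repeating independent rounds until a group is accepted. In each round, with probability $\xi$ a group is proposed with probability proportional to its degree, and with probability $1-\xi$ a group is proposed uniformly at random. A group of the color $c$ of $m$ is always accepted; a group of the other color is accepted with probability $\rho^{(p)}_{c}$ in the first case and $\rho^{(u)}_{c}$ in the second. Let $G_{k,t}(C)$ be the number of groups of color $C$ with degree $k$ at time $t$, and $G_k(C):=\lim_{t\to\infty}\mathbb E[G_{k,t}(C)]/t$. **Constants.** For $x\in[0,1]$ put $D_R(x)=1-(1-\rho^{(p)}_R)\xi(1-x)-(1-\rho^{(u)}_R)(1-\xi)(1-r)$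 and $D_B(x)=1-(1-\rho^{(p)}_B)\xi x-(1-\rho^{(u)}_B)(1-\xi)r$. Let $\alpha^*$ be the solution in $(0,1)$ of $$\alpha^*=r\eta+\frac{r(1-\eta)(\xi\alpha^*+(1-\xi)r)}{D_R(\alpha^*)}+\frac{(1-r)(1-\eta)(\rho^{(p)}_B\xi\alpha^*+\rho^{(u)}_B(1-\xi)r)}{D_B(\alpha^*)},$$ and, with $D_R=D_R(\alpha^*)$, $D_B=D_B(\alpha^*)$, let $$C_{R,1}=\frac{r(1-\eta)\xi}{D_R}+\frac{(1-r)(1-\eta)\rho^{(p)}_B\xi}{D_B},\qquad C_{B,1}=\frac{(1-r)(1-\eta)\xi}{D_B}+\frac{r(1-\eta)\rho^{(p)}_R\xi}{D_R},$$ $$C_{R,2}=\frac{r(1-\eta)(1-\xi)\frac1\eta}{D_R}+\frac{(1-r)(1-\eta)\rho^{(u)}_B(1-\xi)\frac1\eta}{D_B},\qquad C_{B,2}=\frac{(1-r)(1-\eta)(1-\xi)\frac1\eta}{D_B}+\frac{r(1-\eta)\rho^{(u)}_R(1-\xi)\frac1\eta}{D_R},$$ $$k^*=\frac{(1+C_{R,1})(1+C_{B,2})-(1+C_{R,2})(1+C_{B,1})}{C_{R,1}-C_{B,1}}.$$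 **Chasm effect.** The monotonicity of a real sequence $(u_k)_{k\ge1}$ *changes at* the integer $K\ge2$ if $u_k<u_{k+1}$ for $1\le k<K$, $u_K\ge u_{K+1}$, and $u_k>u_{k+1}$ for all $k>K$. The sequence has the *chasm effect* if its monotonicity changes at some $K\ge 2$. **Theorem 5.3.** The number $\alpha^*$ exists and is unique. Assume $C_{R,1}<C_{B,1}$. Then the limits $G_k(R)$ and $G_k(B)$ exist and are positive for all $k\ge1$, and the sequence $\bigl(G_k(R)/G_k(B)\bigr)_{k\ge1}$ has the chasm effect if and only if $k^*>2$. Moreover, if $k^*>2$, then its monotonicity changes at the largest integer that is smaller than $k^*$. -/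

import Mathlib

open Filter Topology MeasureTheory

noncomputable section

namespace GSHM

/-- The two affiliations: red is the minority, blue is the majority. -/
inductive Color
  | red
  | blue
  deriving DecidableEq

/-- The parameters of the generalized selective homophily model. `rhoP c` and `rhoU c` are the
probabilities with which a member of color `c` accepts a group of the other color that was
proposed by the rich-get-richer, respectively by the equal-chance, mechanism. -/
structure Params where
  /-- probability that a new member arrives -/
  alpha : ℝ
  /-- probability that the acting member creates a group -/
  eta : ℝ
  /-- probability that a new member is red -/
  r : ℝ
  /-- probability that a group is proposed by the rich-get-richer mechanism -/
  xi : ℝ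
  rhoP : Color → ℝ
  rhoU : Color → ℝ
  alpha_mem : alpha ∈ Set.Ioo (0 : ℝ) 1
  eta_mem : eta ∈ Set.Ioo (0 : ℝ) 1
  r_mem : r ∈ Set.Ioc (0 : ℝ) (1 / 2)
  xi_mem : xi ∈ Set.Icc (0 : ℝ) 1
  rhoP_mem : ∀ c, rhoP c ∈ Set.Icc (0 : ℝ) 1
  rhoU_mem : ∀ c, rhoU c ∈ Set.Icc (0 : ℝ) 1

/-- A node (member or group) is a serial number together with a color. -/
structure Node where
  id : ℕ
  color : Color
  deriving DecidableEq

/-- A bi-affiliated bipartite (multi)network: the members, the groups, and the multiset of edges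
`(member, group)`. The last field says that there are groups of both colors with at least
one edge, which holds initially and is preserved by the growth. -/
structure Network where
  members : Finset Node
  groups : Finset Node
  edges : Multiset (Node × Node)
  exists_group : ∀ c : Color, ∃ e ∈ edges, e.2 ∈ groups ∧ e.2.color = c

/-- All sets of networks are events (a network is a discrete object). -/
instance : MeasurableSpace Network := ⊤

namespace Network

variable (N : Network)

theorem edges_ne_zero : N.edges ≠ 0 := by
  obtain ⟨e, he, -⟩ := N.exists_group Color.red
  intro h
  simp [h] at he

theorem groups_nonempty : N.groups.Nonempty := by
  obtain ⟨e, -, he, -⟩ := N.exists_group Color.red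
  exact ⟨_, he⟩

theorem memberEnds_ne_zero : N.edges.map Prod.fst ≠ 0 := by
  simpa using N.edges_ne_zero

theorem groupEnds_ne_zero : N.edges.map Prod.snd ≠ 0 := by
  simpa using N.edges_ne_zero

/-- The size (degree) of a group: the number of edges at it. -/
def groupSize (g : Node) : ℕ := (N.edges.map Prod.snd).count g

/-- The number of groups of color `c` and size `k`. -/
def groupCount (c : Color) (k : ℕ) : ℕ :=
  (N.groups.filter fun g => g.color = c ∧ N.groupSize g = k).card

/-- Add the edge `(m, g)`, together with its end points if they are new. -/
def addEdge (m g : Node) : Network where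
  members := insert m N.members
  groups := insert g N.groups
  edges := (m, g) ::ₘ N.edges
  exists_group c := by
    obtain ⟨e, he, hg, hc⟩ := N.exists_group c
    exact ⟨e, Multiset.mem_cons_of_mem he, Finset.mem_insert_of_mem hg, hc⟩

end Network

/-- The initial network (at time `2`): a red member in a red group and a blue member in a blue
group. -/
def init : Network where
  members := {⟨0, Color.red⟩, ⟨1, Color.blue⟩}
  groups := {⟨0, Color.red⟩, ⟨1, Color.blue⟩}
  edges := {(⟨0, Color.red⟩, ⟨0, Color.red⟩), (⟨1, Color.blue⟩, ⟨1, Color.blue⟩)}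
  exists_group c := by cases c <;> simp

/-- A coin that shows `true` with probability `x`. -/
def coin (x : ℝ) (hx : x ∈ Set.Icc (0 : ℝ) 1) : PMF Bool :=
  PMF.ofFintype (fun b => ENNReal.ofReal (if b then x else 1 - x)) (by
    rw [Fintype.sum_bool, if_pos rfl, if_neg Bool.false_ne_true,
      ← ENNReal.ofReal_add hx.1 (sub_nonneg.2 hx.2)]
    simp)

theorem mem_support_coin {x : ℝ} {hx : x ∈ Set.Icc (0 : ℝ) 1} {b : Bool} :
    b ∈ (coin x hx).support ↔ 0 < (if b then x else 1 - x) := by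
  rw [coin, PMF.mem_support_ofFintype_iff, ne_eq, ENNReal.ofReal_eq_zero, not_le]

variable (p : Params) (N : Network)

/-- Member growth: with probability `alpha` a new member (red with probability `r`), otherwise an
existing member, chosen with probability proportional to its degree. -/
def memberStep : PMF Node :=
  (coin p.alpha ⟨p.alpha_mem.1.le, p.alpha_mem.2.le⟩).bind fun new =>
    if new then
      (coin p.r ⟨p.r_mem.1.le, p.r_mem.2.trans (by norm_num)⟩).map fun isRed =>
        ⟨N.members.card, if isRed then Color.red else Color.blue⟩
    else PMF.ofMultiset (N.edges.map Prod.fst) N.memberEnds_ne_zero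

/-- The group that is proposed: under rich-get-richer with probability proportional to its
degree, under equal-chance uniformly. -/
def propose (rich : Bool) : PMF Node :=
  if rich then PMF.ofMultiset (N.edges.map Prod.snd) N.groupEnds_ne_zero
  else PMF.uniformOfFinset N.groups N.groups_nonempty

/-- Whether a member of color `c` accepts the proposed group `g`. -/
def accept (c : Color) (rich : Bool) (g : Node) : PMF Bool :=
  if g.color = c then PMF.pure true
  else if rich then coin (p.rhoP c) (p.rhoP_mem c)
  else coin (p.rhoU c) (p.rhoU_mem c)

/-- One round of the connection growth for a member of color `c`: the proposed group, and whether
it is accepted. -/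
def attempt (c : Color) : PMF (Node × Bool) :=
  (coin p.xi p.xi_mem).bind fun rich =>
    (propose N rich).bind fun g => (accept p c rich g).map fun b => (g, b)

theorem attempt_can_succeed (c : Color) :
    ∃ x ∈ {x : Node × Bool | x.2 = true}, x ∈ (attempt p N c).support := by
  obtain ⟨e, he, hg, hc⟩ := N.exists_group c
  refine ⟨(e.2, true), rfl, ?_⟩
  obtain ⟨rich, hr⟩ := (coin p.xi p.xi_mem).support_nonempty
  simp only [attempt, PMF.mem_support_bind_iff]
  refine ⟨rich, hr, e.2, ?_, ?_⟩
  · cases rich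
    · simpa [propose] using hg
    · simp only [propose, if_true, PMF.mem_support_ofMultiset_iff, Multiset.mem_toFinset,
        Multiset.mem_map]
      exact ⟨e, he, rfl⟩
  · simp [accept, hc]

/-- Connection growth for a member of color `c`: independent rounds are repeated until a group is
accepted, so the joined group has the law of one round conditioned on acceptance. -/
def joinStep (c : Color) : PMF Node :=
  ((attempt p N c).filter {x | x.2 = true} (attempt_can_succeed p N c)).map Prod.fst

/-- One time step: member growth, then with probability `eta` the member creates a group of its
own color, and otherwise it joins an existing group. -/
def step : PMF Network :=
  (memberStep p N).bind fun m =>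
    (coin p.eta ⟨p.eta_mem.1.le, p.eta_mem.2.le⟩).bind fun create =>
      if create then PMF.pure (N.addEdge m ⟨N.groups.card, m.color⟩)
      else (joinStep p N m.color).map fun g => N.addEdge m g

/-- The law of the network after `n` steps, that is, at time `n + 2`. -/
def law : ℕ → PMF Network
  | 0 => PMF.pure init
  | n + 1 => (law n).bind (step p)

/-- The expected number of groups of color `c` and size `k` after `n` steps (at time `n + 2`). -/
def expectedGroups (c : Color) (k n : ℕ) : ℝ :=
  ∫ N, (N.groupCount c k : ℝ) ∂(law p n).toMeasure

/-- `L` is the limit, as the time `t` tends to infinity, of the expected number of groups of color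
`c` and size `k` at time `t`, divided by `t`. -/
def IsLimitGroups (c : Color) (k : ℕ) (L : ℝ) : Prop :=
  Tendsto (fun n : ℕ => expectedGroups p c k n / ((n : ℝ) + 2)) atTop (𝓝 L)

variable (a : ℝ)

/-- The denominator that belongs to a red member. -/
def denR : ℝ :=
  1 - (1 - p.rhoP .red) * p.xi * (1 - a) - (1 - p.rhoU .red) * (1 - p.xi) * (1 - p.r)

/-- The denominator that belongs to a blue member. -/
def denB : ℝ :=
  1 - (1 - p.rhoP .blue) * p.xi * a - (1 - p.rhoU .blue) * (1 - p.xi) * p.r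

/-- `a` lies in `(0, 1)` and solves the equation that determines the limiting share `α*` of the
red groups in the sum of all group sizes. -/
def IsAlphaStar : Prop :=
  a ∈ Set.Ioo (0 : ℝ) 1 ∧
    a = p.r * p.eta
      + p.r * (1 - p.eta) * (p.xi * a + (1 - p.xi) * p.r) / denR p a
      + (1 - p.r) * (1 - p.eta) * (p.rhoP .blue * p.xi * a + p.rhoU .blue * (1 - p.xi) * p.r)
        / denB p a

/-- `C_{R,1}`, at `α* = a`. -/
def CR1 : ℝ :=
  p.r * (1 - p.eta) * p.xi / denR p a
    + (1 - p.r) * (1 - p.eta) * p.rhoP .blue * p.xi / denB p a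

/-- `C_{B,1}`, at `α* = a`. -/
def CB1 : ℝ :=
  (1 - p.r) * (1 - p.eta) * p.xi / denB p a
    + p.r * (1 - p.eta) * p.rhoP .red * p.xi / denR p a

/-- `C_{R,2}`, at `α* = a`. -/
def CR2 : ℝ :=
  p.r * (1 - p.eta) * (1 - p.xi) * (1 / p.eta) / denR p a
    + (1 - p.r) * (1 - p.eta) * p.rhoU .blue * (1 - p.xi) * (1 / p.eta) / denB p a

/-- `C_{B,2}`, at `α* = a`. -/
def CB2 : ℝ :=
  (1 - p.r) * (1 - p.eta) * (1 - p.xi) * (1 / p.eta) / denB p a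
    + p.r * (1 - p.eta) * p.rhoU .red * (1 - p.xi) * (1 / p.eta) / denR p a

/-- The threshold `k*`, at `α* = a`. -/
def kStar : ℝ :=
  ((1 + CR1 p a) * (1 + CB2 p a) - (1 + CR2 p a) * (1 + CB1 p a)) / (CR1 p a - CB1 p a)

/-- The monotonicity of the sequence `u 1, u 2, …` changes at `K`, from increasing to decreasing:
each step that starts at some `k < K` is a strict increase, and there is such a step (`2 ≤ K`);
each step that starts at some `k > K` is a strict decrease; the step from `K` is not an
increase. At most one `K` has this property. -/
def ChangesAt (u : ℕ → ℝ) (K : ℕ) : Prop :=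
  2 ≤ K ∧ (∀ k, 1 ≤ k → k < K → u k < u (k + 1)) ∧ u (K + 1) ≤ u K ∧
    ∀ k, K < k → u (k + 1) < u k

/-- The chasm effect for the sequence `u 1, u 2, …`: first increasing, then decreasing. -/
def HasChasm (u : ℕ → ℝ) : Prop := ∃ K, ChangesAt u K

end GSHM

end

/-!
The proof follows the law of the network through conditional expectations; only means and second
moments are needed. Convergence in probability is expressed by the filter `aas p` of the events
that hold asymptotically almost surely, so that the usual limit rules apply to functions of the
network.

*The shares.* A counter that grows by at most one in each step, divided by the number of edges,
follows a stochastic approximation `x ↦ x + (B - x) / (t + 1)`. If its drift points to `θ`, then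
`E (x - θ) ^ 2` contracts by a factor `1 - c / t` up to smaller errors, and tends to `0` because the
harmonic series diverges (`tendsto_zero_of_contraction`, `tendsto_share`). This yields, one after
the other, that the share of the edges with a red member tends to `r`, that the numbers of groups
and of red groups per edge tend to `η` and `η r`, and that the share `x` of the edges at red groups
tends to `α*`.

*The number `α*`.* In the last case the drift is `F x - x` up to a vanishing error, where `F x = x`
is the equation of `α*`. Over the common denominator, `F x - x` is a cubic with nonnegative leading
coefficient that is positive at `0` and negative at `1`. Divided by `x - a`, for a root `a` in
`(0, 1)`, it becomes a convex quadratic that is negative at both ends of `[0, 1]`, hence bounded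
away from `0` on `[0, 1]` (`driftCubic_factor`). This gives both the uniqueness of `α*` and the
contraction towards it.

*The group sizes.* The probability that the new edge joins a group of color `C` and size `k` is the
number of these groups per edge times a random rate that converges in probability to
`C_{C,1} k + C_{C,2}`. The expected numbers per edge therefore satisfy a perturbed linear recursion,
which converges to the solution `limGroups` of
`(1 + w (k + 1)) G (k + 1) = w k * G k + [k = 0] η r_C` with `w k = C_{C,1} k + C_{C,2}`
(`tendsto_expect_groupDensity`).

*The ratio.* The quotient of consecutive ratios is explicit, and its comparison with `1` amounts to
the comparison of `k` with `k* - 1` (`ratio_step`).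
-/

noncomputable section

namespace GSHM

/-! ### Expectations under finitely supported laws -/

section Expectation

variable {α β : Type*}

/-- The expectation of `f` under `q`, as a sum over the whole type. It is used only when the
support of `q` is finite, so that the sum has finitely many nonzero terms. -/
def expect (q : PMF α) (f : α → ℝ) : ℝ := ∑' x, (q x).toReal * f x

theorem apply_eq_zero_of_notMem_toFinset {q : PMF α} (hq : q.support.Finite) {x : α}
    (hx : x ∉ hq.toFinset) : q x = 0 :=
  (q.apply_eq_zero_iff x).2 fun h => hx (hq.mem_toFinset.2 h)

theorem expect_eq_sum {q : PMF α} {s : Finset α} (hs : ∀ x ∈ q.support, x ∈ s) (f : α → ℝ) :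
    expect q f = ∑ x ∈ s, (q x).toReal * f x := by
  refine tsum_eq_sum fun x hx => ?_
  have h : q x = 0 := (q.apply_eq_zero_iff x).2 fun h => hx (hs x h)
  simp [h]

theorem expect_eq_sum_support {q : PMF α} (hq : q.support.Finite) (f : α → ℝ) :
    expect q f = ∑ x ∈ hq.toFinset, (q x).toReal * f x :=
  expect_eq_sum (by simp) f

theorem sum_toReal_support {q : PMF α} (hq : q.support.Finite) :
    ∑ x ∈ hq.toFinset, (q x).toReal = 1 := by
  rw [← ENNReal.toReal_sum fun x _ => q.apply_ne_top x,
    ← tsum_eq_sum (L := .unconditional α) (f := fun x => q x) fun x hx =>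
      apply_eq_zero_of_notMem_toFinset hq hx, q.tsum_coe, ENNReal.toReal_one]

theorem expect_const {q : PMF α} (hq : q.support.Finite) (a : ℝ) : expect q (fun _ => a) = a := by
  rw [expect_eq_sum_support hq, ← Finset.sum_mul, sum_toReal_support hq, one_mul]

theorem expect_add {q : PMF α} (hq : q.support.Finite) (f g : α → ℝ) :
    expect q (fun x => f x + g x) = expect q f + expect q g := by
  simp only [expect_eq_sum_support hq, mul_add, Finset.sum_add_distrib]

theorem expect_sub {q : PMF α} (hq : q.support.Finite) (f g : α → ℝ) :
    expect q (fun x => f x - g x) = expect q f - expect q g := by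
  simp only [expect_eq_sum_support hq, mul_sub, Finset.sum_sub_distrib]

theorem expect_const_mul (q : PMF α) (a : ℝ) (f : α → ℝ) :
    expect q (fun x => a * f x) = a * expect q f := by
  simp only [expect, mul_left_comm _ a, tsum_mul_left]

theorem expect_congr {q : PMF α} {f g : α → ℝ} (h : ∀ x ∈ q.support, f x = g x) :
    expect q f = expect q g := by
  refine tsum_congr fun x => ?_
  by_cases hx : x ∈ q.support
  · rw [h x hx]
  · simp [(q.apply_eq_zero_iff x).2 hx]

theorem expect_mono {q : PMF α} (hq : q.support.Finite) {f g : α → ℝ}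
    (h : ∀ x ∈ q.support, f x ≤ g x) : expect q f ≤ expect q g := by
  simp only [expect_eq_sum_support hq]
  exact Finset.sum_le_sum fun x hx =>
    mul_le_mul_of_nonneg_left (h x (by simpa using hx)) ENNReal.toReal_nonneg

theorem expect_nonneg {q : PMF α} {f : α → ℝ}
    (h : ∀ x ∈ q.support, 0 ≤ f x) : 0 ≤ expect q f := by
  refine tsum_nonneg fun x => ?_
  by_cases hx : x ∈ q.support
  · exact mul_nonneg ENNReal.toReal_nonneg (h x hx)
  · simp [(q.apply_eq_zero_iff x).2 hx]

theorem abs_expect_le {q : PMF α} (hq : q.support.Finite) (f : α → ℝ) :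
    |expect q f| ≤ expect q fun x => |f x| := by
  simp only [expect_eq_sum_support hq]
  refine (Finset.abs_sum_le_sum_abs _ _).trans (le_of_eq (Finset.sum_congr rfl fun x _ => ?_))
  rw [abs_mul, abs_of_nonneg ENNReal.toReal_nonneg]

theorem finite_support_pure (a : α) : (PMF.pure a).support.Finite := by simp

theorem finite_support_bind {q : PMF α} (hq : q.support.Finite) {k : α → PMF β}
    (hk : ∀ x, (k x).support.Finite) : (q.bind k).support.Finite := by
  rw [PMF.support_bind]
  exact hq.biUnion fun x _ => hk x

theorem finite_support_map {q : PMF α} (hq : q.support.Finite) (g : α → β) :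
    (q.map g).support.Finite := by
  rw [PMF.support_map]
  exact hq.image g

theorem finite_support_filter {q : PMF α} (hq : q.support.Finite) {s : Set α}
    (h : ∃ a ∈ s, a ∈ q.support) : (q.filter s h).support.Finite := by
  rw [PMF.support_filter]
  exact hq.inter_of_right s

theorem finite_support_ofMultiset (s : Multiset α) (hs : s ≠ 0) :
    (PMF.ofMultiset s hs).support.Finite := by
  classical
  rw [PMF.support_ofMultiset]
  exact Set.toFinite _

theorem finite_support_uniformOfFinset (s : Finset α) (hs : s.Nonempty) :
    (PMF.uniformOfFinset s hs).support.Finite := by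
  rw [PMF.support_uniformOfFinset]
  exact Set.toFinite _

theorem expect_pure (a : α) (f : α → ℝ) : expect (PMF.pure a) f = f a := by
  rw [expect_eq_sum (s := {a}) (by simp)]
  simp

theorem expect_bind {q : PMF α} (hq : q.support.Finite) {k : α → PMF β}
    (hk : ∀ x, (k x).support.Finite) (f : β → ℝ) :
    expect (q.bind k) f = expect q fun x => expect (k x) f := by
  classical
  have hb := finite_support_bind hq hk
  have hsub : ∀ x ∈ hq.toFinset, ∀ y ∈ (k x).support, y ∈ hb.toFinset := by
    intro x hx y hy
    rw [Set.Finite.mem_toFinset, PMF.mem_support_bind_iff]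
    exact ⟨x, by simpa using hx, hy⟩
  rw [expect_eq_sum_support hb, expect_eq_sum_support hq]
  have h1 : ∀ y, ((q.bind k) y).toReal
      = ∑ x ∈ hq.toFinset, (q x).toReal * (k x y).toReal := by
    intro y
    rw [PMF.bind_apply, tsum_eq_sum (s := hq.toFinset) (fun x hx => by
      simp [apply_eq_zero_of_notMem_toFinset hq hx]), ENNReal.toReal_sum fun x _ =>
        ENNReal.mul_ne_top (q.apply_ne_top x) ((k x).apply_ne_top y)]
    simp only [ENNReal.toReal_mul]
  simp only [h1, Finset.sum_mul]
  rw [Finset.sum_comm]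
  refine Finset.sum_congr rfl fun x hx => ?_
  rw [expect_eq_sum (hsub x hx), Finset.mul_sum]
  simp only [mul_assoc]

theorem expect_map {q : PMF α} (hq : q.support.Finite) (g : α → β) (f : β → ℝ) :
    expect (q.map g) f = expect q fun x => f (g x) := by
  rw [← PMF.bind_pure_comp, expect_bind hq (k := PMF.pure ∘ g) fun _ => finite_support_pure _]
  simp only [Function.comp_apply, expect_pure]

theorem expect_coin {x : ℝ} (hx : x ∈ Set.Icc (0 : ℝ) 1) (f : Bool → ℝ) :
    expect (coin x hx) f = x * f true + (1 - x) * f false := by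
  rw [expect, tsum_fintype, Fintype.sum_bool]
  simp [coin, PMF.ofFintype_apply, ENNReal.toReal_ofReal hx.1,
    ENNReal.toReal_ofReal (sub_nonneg.2 hx.2)]

theorem expect_coin_bind {x : ℝ} (hx : x ∈ Set.Icc (0 : ℝ) 1) {k : Bool → PMF β}
    (hk : ∀ b, (k b).support.Finite) (f : β → ℝ) :
    expect ((coin x hx).bind k) f = x * expect (k true) f + (1 - x) * expect (k false) f := by
  rw [expect_bind (Set.toFinite _) hk, expect_coin]

theorem expect_ofMultiset (s : Multiset α) (hs : s ≠ 0) (f : α → ℝ) :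
    expect (PMF.ofMultiset s hs) f = (s.map f).sum / s.card := by
  classical
  rw [expect_eq_sum (s := s.toFinset) (by simp), Finset.sum_multiset_map_count, Finset.sum_div]
  refine Finset.sum_congr rfl fun x _ => ?_
  rw [PMF.ofMultiset_apply]
  simp only [ENNReal.toReal_div, ENNReal.toReal_natCast, nsmul_eq_mul]
  ring

theorem expect_uniformOfFinset (s : Finset α) (hs : s.Nonempty) (f : α → ℝ) :
    expect (PMF.uniformOfFinset s hs) f = (∑ x ∈ s, f x) / s.card := by
  rw [expect_eq_sum (s := s) (by simp), Finset.sum_div]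
  refine Finset.sum_congr rfl fun x hx => ?_
  rw [PMF.uniformOfFinset_apply_of_mem hs hx]
  simp [div_eq_inv_mul]

theorem expect_filter {q : PMF α} (hq : q.support.Finite) {s : Set α}
    (h : ∃ a ∈ s, a ∈ q.support) (f : α → ℝ) :
    expect (q.filter s h) f = expect q (s.indicator f) / expect q (s.indicator fun _ => 1) := by
  classical
  have h1 : (∑' a, s.indicator q a).toReal = expect q (s.indicator fun _ => 1) := by
    rw [expect_eq_sum_support hq, tsum_eq_sum (s := hq.toFinset) (fun x hx => by
      simp [Set.indicator, apply_eq_zero_of_notMem_toFinset hq hx]), ENNReal.toReal_sum]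
    · refine Finset.sum_congr rfl fun x _ => ?_
      by_cases hx : x ∈ s <;> simp [hx]
    · intro x _
      by_cases hx : x ∈ s <;> simp [hx, q.apply_ne_top x]
  rw [expect_eq_sum (s := hq.toFinset) (by simp [PMF.support_filter]),
    expect_eq_sum_support hq (s.indicator f), Finset.sum_div]
  refine Finset.sum_congr rfl fun x _ => ?_
  rw [PMF.filter_apply, ENNReal.toReal_mul, ENNReal.toReal_inv, h1]
  by_cases hx : x ∈ s <;> simp [hx]
  ring

theorem integral_eq_expect [MeasurableSpace α] {q : PMF α} (hq : q.support.Finite)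
    [MeasurableSingletonClass α] (f : α → ℝ) : ∫ x, f x ∂q.toMeasure = expect q f := by
  have h0 : ∀ᵐ x ∂q.toMeasure, x ∈ q.support := by
    rw [ae_iff]
    change q.toMeasure (q.support)ᶜ = 0
    rw [PMF.toMeasure_apply_eq_zero_iff _ hq.measurableSet.compl]
    exact disjoint_compl_right
  have h1 : q.toMeasure.restrict q.support = q.toMeasure := Measure.restrict_eq_self_of_ae_mem h0
  rw [PMF.integral_eq_tsum]
  · simp [expect]
  · rw [← h1]
    exact IntegrableOn.of_finite hq

end Expectation

/-! ### One step of the growth -/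

section Step

/-- The probability that a new member has color `c`. -/
def colorProb (p : Params) : Color → ℝ
  | .red => p.r
  | .blue => 1 - p.r

/-- The probability that a member of color `c` accepts a group of color `C` that was proposed by
the rich-get-richer mechanism. -/
def acceptP (p : Params) (c C : Color) : ℝ := if C = c then 1 else p.rhoP c

/-- The probability that a member of color `c` accepts a group of color `C` that was proposed by
the equal-chance mechanism. -/
def acceptU (p : Params) (c C : Color) : ℝ := if C = c then 1 else p.rhoU c

/-- The share of the edges whose member has color `c`. -/
def memberShare (N : Network) (c : Color) : ℝ :=
  (N.edges.countP fun e => e.1.color = c : ℝ) / N.edges.card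

/-- The share of the edges whose group has color `c`. -/
def edgeShare (N : Network) (c : Color) : ℝ :=
  (N.edges.countP fun e => e.2.color = c : ℝ) / N.edges.card

/-- The share of the groups that have color `c`. -/
def groupShare (N : Network) (c : Color) : ℝ :=
  ((N.groups.filter fun g => g.color = c).card : ℝ) / N.groups.card

/-- The probability that the acting member has color `c`. -/
def actorProb (p : Params) (N : Network) (c : Color) : ℝ :=
  p.alpha * colorProb p c + (1 - p.alpha) * memberShare N c

/-- The expectation, over one round of a member of color `c`, of `f` at the proposed group on the
event that this group is accepted. -/
def acceptMean (p : Params) (N : Network) (c : Color) (f : Node → ℝ) : ℝ :=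
  p.xi * ((N.edges.map fun e => acceptP p c e.2.color * f e.2).sum / N.edges.card)
    + (1 - p.xi) * ((∑ g ∈ N.groups, acceptU p c g.color * f g) / N.groups.card)

/-- The acceptance probability of one round of a member of color `c`, when `x` and `y` are the
shares of the red groups in the group sizes and among the groups. -/
def roundDen (p : Params) (c : Color) (x y : ℝ) : ℝ :=
  p.xi * (acceptP p c .red * x + acceptP p c .blue * (1 - x))
    + (1 - p.xi) * (acceptU p c .red * y + acceptU p c .blue * (1 - y))

/-- The edge that is added in one time step. -/
def stepEdge (p : Params) (N : Network) : PMF (Node × Node) :=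
  (memberStep p N).bind fun m =>
    (coin p.eta ⟨p.eta_mem.1.le, p.eta_mem.2.le⟩).bind fun create =>
      if create then PMF.pure (m, ⟨N.groups.card, m.color⟩)
      else (joinStep p N m.color).map fun g => (m, g)

variable (p : Params) (N : Network)

theorem alpha_mem_Icc : p.alpha ∈ Set.Icc (0 : ℝ) 1 := Set.Ioo_subset_Icc_self p.alpha_mem

theorem eta_mem_Icc : p.eta ∈ Set.Icc (0 : ℝ) 1 := Set.Ioo_subset_Icc_self p.eta_mem

theorem r_mem_Icc : p.r ∈ Set.Icc (0 : ℝ) 1 := ⟨p.r_mem.1.le, p.r_mem.2.trans (by norm_num)⟩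

theorem step_eq_map : step p N = (stepEdge p N).map fun e => N.addEdge e.1 e.2 := by
  rw [step, stepEdge, PMF.map_bind]
  congr 1
  funext m
  rw [PMF.map_bind]
  congr 1
  funext b
  cases b
  · simp [PMF.map_comp, Function.comp_def]
  · simp [PMF.pure_map]

theorem finite_support_memberStep : (memberStep p N).support.Finite := by
  refine finite_support_bind (Set.toFinite _) fun b => ?_
  cases b
  · exact finite_support_ofMultiset _ N.memberEnds_ne_zero
  · exact finite_support_map (Set.toFinite _) _

theorem finite_support_propose (rich : Bool) : (propose N rich).support.Finite := by
  cases rich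
  · exact finite_support_uniformOfFinset _ N.groups_nonempty
  · exact finite_support_ofMultiset _ N.groupEnds_ne_zero

theorem finite_support_attempt (c : Color) : (attempt p N c).support.Finite :=
  finite_support_bind (Set.toFinite _) fun b =>
    finite_support_bind (finite_support_propose N b) fun _ =>
      finite_support_map (Set.toFinite _) _

theorem finite_support_joinStep (c : Color) : (joinStep p N c).support.Finite :=
  finite_support_map (finite_support_filter (finite_support_attempt p N c) _) _

theorem finite_support_stepEdge : (stepEdge p N).support.Finite := by
  refine finite_support_bind (finite_support_memberStep p N) fun m =>
    finite_support_bind (Set.toFinite _) fun b => ?_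
  cases b
  · exact finite_support_map (finite_support_joinStep p N _) _
  · exact finite_support_pure _

theorem finite_support_step : (step p N).support.Finite := by
  rw [step_eq_map]
  exact finite_support_map (finite_support_stepEdge p N) _

theorem finite_support_law (n : ℕ) : (law p n).support.Finite := by
  induction n with
  | zero => exact finite_support_pure _
  | succ n ih => exact finite_support_bind ih (finite_support_step p)

theorem expect_law_succ (n : ℕ) (f : Network → ℝ) :
    expect (law p (n + 1)) f
      = expect (law p n) fun N => expect (stepEdge p N) fun e => f (N.addEdge e.1 e.2) := by
  rw [law, expect_bind (finite_support_law p n) (finite_support_step p)]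
  congr 1
  funext N
  rw [step_eq_map, expect_map (finite_support_stepEdge p N)]

theorem sum_map_color {β : Type*} (s : Multiset β) (col : β → Color) (φ : Color → ℝ) :
    (s.map fun e => φ (col e)).sum
      = s.countP (fun e => col e = .red) * φ .red + s.countP (fun e => col e = .blue) * φ .blue := by
  induction s using Multiset.induction_on with
  | empty => simp
  | cons a s ih =>
    rw [Multiset.map_cons, Multiset.sum_cons, ih]
    cases h : col a <;> simp [h] <;> ring

theorem card_edges_pos : (0 : ℝ) < N.edges.card := by
  exact_mod_cast Multiset.card_pos.2 N.edges_ne_zero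

theorem card_groups_pos : (0 : ℝ) < N.groups.card := by
  exact_mod_cast N.groups_nonempty.card_pos

theorem memberShare_blue : memberShare N .blue = 1 - memberShare N .red := by
  have h := sum_map_color N.edges (fun e => e.1.color) fun _ => 1
  have h0 := (card_edges_pos N).ne'
  simp only [Multiset.map_const', Multiset.sum_replicate, nsmul_eq_mul, mul_one] at h
  rw [memberShare, memberShare, eq_sub_iff_add_eq', ← add_div, ← h, div_self h0]

theorem edgeShare_blue : edgeShare N .blue = 1 - edgeShare N .red := by
  have h := sum_map_color N.edges (fun e => e.2.color) fun _ => 1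
  have h0 := (card_edges_pos N).ne'
  simp only [Multiset.map_const', Multiset.sum_replicate, nsmul_eq_mul, mul_one] at h
  rw [edgeShare, edgeShare, eq_sub_iff_add_eq', ← add_div, ← h, div_self h0]

theorem sum_groups_color (φ : Color → ℝ) :
    ∑ g ∈ N.groups, φ g.color = (N.groups.filter fun g => g.color = .red).card * φ .red
      + (N.groups.filter fun g => g.color = .blue).card * φ .blue := by
  have h := sum_map_color N.groups.val Node.color φ
  simp only [Multiset.countP_eq_card_filter] at h
  exact h

theorem groupShare_blue : groupShare N .blue = 1 - groupShare N .red := by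
  have h := sum_groups_color N fun _ => 1
  have h0 := (card_groups_pos N).ne'
  simp only [Finset.sum_const, nsmul_eq_mul, mul_one] at h
  rw [groupShare, groupShare, eq_sub_iff_add_eq', ← add_div, ← h, div_self h0]

theorem memberShare_mem (c : Color) : memberShare N c ∈ Set.Icc (0 : ℝ) 1 := by
  refine ⟨by unfold memberShare; positivity, div_le_one_of_le₀ ?_ (Nat.cast_nonneg _)⟩
  exact_mod_cast Multiset.countP_le_card _ _

theorem edgeShare_mem (c : Color) : edgeShare N c ∈ Set.Icc (0 : ℝ) 1 := by
  refine ⟨by unfold edgeShare; positivity, div_le_one_of_le₀ ?_ (Nat.cast_nonneg _)⟩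
  exact_mod_cast Multiset.countP_le_card _ _

theorem groupShare_mem (c : Color) : groupShare N c ∈ Set.Icc (0 : ℝ) 1 := by
  refine ⟨by unfold groupShare; positivity, div_le_one_of_le₀ ?_ (Nat.cast_nonneg _)⟩
  exact_mod_cast Finset.card_filter_le _ _

theorem colorProb_mem (c : Color) : colorProb p c ∈ Set.Ioo (0 : ℝ) 1 := by
  obtain ⟨h1, h2⟩ := p.r_mem
  cases c <;> constructor <;> simp only [colorProb] <;> linarith

theorem actorProb_blue : actorProb p N .blue = 1 - actorProb p N .red := by
  simp only [actorProb, memberShare_blue, colorProb]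
  ring

theorem actorProb_mem (c : Color) : actorProb p N c ∈ Set.Icc (0 : ℝ) 1 := by
  obtain ⟨h1, h2⟩ := colorProb_mem p c
  obtain ⟨h3, h4⟩ := memberShare_mem N c
  obtain ⟨h5, h6⟩ := p.alpha_mem
  constructor <;> simp only [actorProb]
  · have := sub_pos.2 h6
    positivity
  · nlinarith

theorem acceptP_mem (c C : Color) : acceptP p c C ∈ Set.Icc (0 : ℝ) 1 := by
  unfold acceptP
  split_ifs
  · simp
  · exact p.rhoP_mem c

theorem acceptU_mem (c C : Color) : acceptU p c C ∈ Set.Icc (0 : ℝ) 1 := by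
  unfold acceptU
  split_ifs
  · simp
  · exact p.rhoU_mem c

theorem expect_memberStep (φ : Color → ℝ) :
    expect (memberStep p N) (fun m => φ m.color)
      = actorProb p N .red * φ .red + actorProb p N .blue * φ .blue := by
  rw [memberStep]
  refine (expect_coin_bind (alpha_mem_Icc p) ?_ _).trans ?_
  rotate_left
  · rw [if_pos rfl, if_neg Bool.false_ne_true, expect_map (Set.toFinite _), expect_coin (r_mem_Icc p),
      expect_ofMultiset, Multiset.map_map]
    simp only [Function.comp_def, Multiset.card_map]
    rw [sum_map_color N.edges (fun e => e.1.color) φ]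
    simp only [actorProb, memberShare, colorProb, if_true, Bool.false_eq_true, if_false]
    ring
  · intro b
    cases b
    · exact finite_support_ofMultiset _ N.memberEnds_ne_zero
    · exact finite_support_map (Set.toFinite _) _

theorem expect_accept (c : Color) (rich : Bool) (g : Node) (a : ℝ) :
    expect (accept p c rich g) (fun b => if b = true then a else 0)
      = (if rich then acceptP p c g.color else acceptU p c g.color) * a := by
  unfold accept acceptP acceptU
  split_ifs <;> simp [expect_pure, expect_coin]

theorem expect_attempt (c : Color) (f : Node → ℝ) :
    expect (attempt p N c) (fun x => if x.2 = true then f x.1 else 0) = acceptMean p N c f := by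
  have hfin : ∀ (rich : Bool) (g : Node),
      ((accept p c rich g).map fun b => (g, b)).support.Finite := fun rich g =>
    finite_support_map (Set.toFinite _) _
  rw [attempt, expect_coin_bind _ fun b => finite_support_bind (finite_support_propose N b) (hfin b),
    expect_bind (finite_support_propose N true) (hfin true),
    expect_bind (finite_support_propose N false) (hfin false)]
  simp only [expect_map (Set.toFinite _), expect_accept]
  simp only [propose, if_true, Bool.false_eq_true, if_false, expect_ofMultiset,
    expect_uniformOfFinset, Multiset.map_map, Multiset.card_map, Function.comp_def]
  rfl

theorem expect_joinStep (c : Color) (f : Node → ℝ) :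
    expect (joinStep p N c) f = acceptMean p N c f / acceptMean p N c fun _ => 1 := by
  have hi : ∀ h : Node → ℝ, ({x : Node × Bool | x.2 = true}.indicator fun x => h x.1)
      = fun x => if x.2 = true then h x.1 else 0 := by
    intro h
    funext x
    simp [Set.indicator]
  rw [joinStep, expect_map (finite_support_filter (finite_support_attempt p N c) _),
    expect_filter (finite_support_attempt p N c), hi f, hi fun _ => 1, expect_attempt,
    expect_attempt p N c fun _ => 1]

theorem acceptMean_color (c : Color) (φ : Color → ℝ) :
    acceptMean p N c (fun g => φ g.color)
      = p.xi * (acceptP p c .red * φ .red * edgeShare N .red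
          + acceptP p c .blue * φ .blue * edgeShare N .blue)
        + (1 - p.xi) * (acceptU p c .red * φ .red * groupShare N .red
          + acceptU p c .blue * φ .blue * groupShare N .blue) := by
  unfold acceptMean
  rw [sum_map_color N.edges (fun e => e.2.color) fun C => acceptP p c C * φ C,
    sum_groups_color N fun C => acceptU p c C * φ C]
  simp only [edgeShare, groupShare]
  ring

theorem acceptMean_one (c : Color) :
    acceptMean p N c (fun _ => 1) = roundDen p c (edgeShare N .red) (groupShare N .red) := by
  rw [acceptMean_color p N c fun _ => 1, edgeShare_blue, groupShare_blue, roundDen]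
  ring

theorem expect_stepEdge (φ : Color → Node → ℝ) :
    expect (stepEdge p N) (fun e => φ e.1.color e.2)
      = actorProb p N .red * (p.eta * φ .red ⟨N.groups.card, .red⟩
          + (1 - p.eta) * expect (joinStep p N .red) (φ .red))
        + actorProb p N .blue * (p.eta * φ .blue ⟨N.groups.card, .blue⟩
          + (1 - p.eta) * expect (joinStep p N .blue) (φ .blue)) := by
  have hfin : ∀ (m : Node) (b : Bool), (if b then PMF.pure (m, (⟨N.groups.card, m.color⟩ : Node))
      else (joinStep p N m.color).map fun g => (m, g)).support.Finite := by
    intro m b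
    cases b
    · exact finite_support_map (finite_support_joinStep p N _) _
    · exact finite_support_pure _
  rw [stepEdge, expect_bind (finite_support_memberStep p N) fun m =>
    finite_support_bind (Set.toFinite _) (hfin m)]
  have hm : ∀ m : Node, expect ((coin p.eta (eta_mem_Icc p)).bind fun create =>
      if create then PMF.pure (m, (⟨N.groups.card, m.color⟩ : Node))
      else (joinStep p N m.color).map fun g => (m, g)) (fun e => φ e.1.color e.2)
      = p.eta * φ m.color ⟨N.groups.card, m.color⟩
        + (1 - p.eta) * expect (joinStep p N m.color) (φ m.color) := by
    intro m
    rw [expect_coin_bind _ (hfin m), if_pos rfl, if_neg Bool.false_ne_true, expect_pure,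
      expect_map (finite_support_joinStep p N _)]
  refine (congrArg (expect (memberStep p N)) (funext hm)).trans ?_
  exact expect_memberStep p N fun c => p.eta * φ c ⟨N.groups.card, c⟩
    + (1 - p.eta) * expect (joinStep p N c) (φ c)

end Step

/-! ### Networks that occur in the growth -/

section Reachable

/-- The properties of the networks that occur in the growth: the serial numbers of the groups are
smaller than the number of groups, so that a created group is new, and the groups are exactly the
group ends of the edges. -/
structure Network.Regular (N : Network) : Prop where
  id_lt : ∀ g ∈ N.groups, g.id < N.groups.card
  mem_iff : ∀ g, g ∈ N.groups ↔ g ∈ N.edges.map Prod.snd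

theorem Network.Regular.new_notMem {N : Network} (hN : N.Regular) (c : Color) :
    (⟨N.groups.card, c⟩ : Node) ∉ N.groups := fun h => lt_irrefl _ (hN.id_lt _ h)

theorem Network.Regular.groupSize_eq_zero {N : Network} (hN : N.Regular) {g : Node}
    (hg : g ∉ N.groups) : N.groupSize g = 0 :=
  Multiset.count_eq_zero.2 fun h => hg ((hN.mem_iff g).2 h)

theorem Network.Regular.groupSize_pos {N : Network} (hN : N.Regular) {g : Node}
    (hg : g ∈ N.groups) : 0 < N.groupSize g :=
  Multiset.count_pos.2 ((hN.mem_iff g).1 hg)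

theorem Network.Regular.card_groups_le {N : Network} (hN : N.Regular) :
    N.groups.card ≤ N.edges.card := by
  have h : N.groups = (N.edges.map Prod.snd).toFinset := by
    ext g
    rw [hN.mem_iff, Multiset.mem_toFinset]
  rw [h, ← Multiset.card_map Prod.snd N.edges]
  exact Multiset.toFinset_card_le _

theorem regular_init : init.Regular := by
  constructor
  · intro g hg
    simp only [init, Finset.mem_insert, Finset.mem_singleton] at hg
    rcases hg with rfl | rfl <;> simp [init]
  · intro g
    simp [init]

variable (p : Params)

theorem mem_groups_of_mem_joinStep {N : Network} (hN : N.Regular) {c : Color} {g : Node}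
    (hg : g ∈ (joinStep p N c).support) : g ∈ N.groups := by
  rw [joinStep, PMF.mem_support_map_iff] at hg
  obtain ⟨x, hx, rfl⟩ := hg
  rw [PMF.mem_support_filter_iff] at hx
  have h := hx.2
  simp only [attempt, PMF.mem_support_bind_iff, PMF.mem_support_map_iff] at h
  obtain ⟨rich, -, g, hg, b, -, rfl⟩ := h
  cases rich
  · simpa [propose] using hg
  · simp only [propose, if_true, PMF.mem_support_ofMultiset_iff, Multiset.mem_toFinset] at hg
    exact (hN.mem_iff g).2 hg

theorem mem_support_stepEdge {N : Network} (hN : N.Regular) {e : Node × Node}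
    (he : e ∈ (stepEdge p N).support) :
    e.2 ∈ N.groups ∨ e.2 = ⟨N.groups.card, e.1.color⟩ := by
  simp only [stepEdge, PMF.mem_support_bind_iff] at he
  obtain ⟨m, -, b, -, he⟩ := he
  cases b
  · simp only [Bool.false_eq_true, if_false, PMF.mem_support_map_iff] at he
    obtain ⟨g, hg, rfl⟩ := he
    exact Or.inl (mem_groups_of_mem_joinStep p hN hg)
  · simp only [if_true, PMF.mem_support_pure_iff] at he
    subst he
    exact Or.inr rfl

theorem regular_addEdge {N : Network} (hN : N.Regular) {m g : Node}
    (hg : g ∈ N.groups ∨ g.id = N.groups.card) : (N.addEdge m g).Regular := by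
  constructor
  · intro h hh
    simp only [Network.addEdge, Finset.mem_insert] at hh ⊢
    by_cases hmem : g ∈ N.groups
    · rw [Finset.insert_eq_of_mem hmem]
      rcases hh with rfl | hh
      · exact hN.id_lt _ hmem
      · exact hN.id_lt _ hh
    · have hid := hg.resolve_left hmem
      rw [Finset.card_insert_of_notMem hmem]
      rcases hh with rfl | hh
      · omega
      · exact (hN.id_lt _ hh).trans (Nat.lt_succ_self _)
  · intro h
    simp only [Network.addEdge, Finset.mem_insert, Multiset.map_cons, Multiset.mem_cons,
      hN.mem_iff]

theorem law_support {n : ℕ} {N : Network} (hN : N ∈ (law p n).support) :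
    N.Regular ∧ N.edges.card = n + 2 := by
  induction n generalizing N with
  | zero =>
    simp only [law, PMF.mem_support_pure_iff] at hN
    subst hN
    exact ⟨regular_init, rfl⟩
  | succ n ih =>
    simp only [law, PMF.mem_support_bind_iff] at hN
    obtain ⟨M, hM, hN⟩ := hN
    obtain ⟨hreg, hcard⟩ := ih hM
    rw [step_eq_map, PMF.mem_support_map_iff] at hN
    obtain ⟨e, he, rfl⟩ := hN
    refine ⟨regular_addEdge hreg ?_, ?_⟩
    · rcases mem_support_stepEdge p hreg he with h | h
      · exact Or.inl h
      · exact Or.inr (by rw [h])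
    · simp [Network.addEdge, hcard]

end Reachable

/-! ### A recursive inequality -/

/-- A nonnegative sequence that contracts by the factor `1 - c / (n + 3)` up to an error of
smaller order tends to `0`, since the harmonic series diverges. -/
theorem tendsto_zero_of_contraction {v ε : ℕ → ℝ} {c : ℝ} (hc : 0 < c) (hv : ∀ n, 0 ≤ v n)
    (hε : Tendsto ε atTop (𝓝 0))
    (h : ∀ᶠ n : ℕ in atTop, v (n + 1) ≤ (1 - c / (n + 3)) * v n + ε n / (n + 3)) :
    Tendsto v atTop (𝓝 0) := by
  have hpos : ∀ n : ℕ, (0 : ℝ) < n + 3 := fun n => by positivity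
  rw [tendsto_order]
  refine ⟨fun a ha => Eventually.of_forall fun n => ha.trans_le (hv n), fun δ hδ => ?_⟩
  have hε' : ∀ᶠ n in atTop, ε n < c * (δ / 2) := hε.eventually_lt_const (by positivity)
  have hc' : ∀ᶠ n : ℕ in atTop, c ≤ n := (tendsto_natCast_atTop_atTop).eventually_ge_atTop c
  obtain ⟨n₀, hn₀⟩ := eventually_atTop.1 (h.and (hε'.and hc'))
  -- The excess of `v` over `δ / 2` contracts without any error.
  set w : ℕ → ℝ := fun n => max (v n - δ / 2) 0 with hw
  have hw0 : ∀ n, 0 ≤ w n := fun n => le_max_right _ _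
  have hstep : ∀ n, n₀ ≤ n → w (n + 1) ≤ Real.exp (-(c / (n + 3))) * w n := by
    intro n hn
    obtain ⟨h1, h2, h3⟩ := hn₀ n hn
    have hq : 0 ≤ 1 - c / (n + 3) := by
      rw [sub_nonneg, div_le_one (hpos n)]
      linarith
    have hle : (1 - c / (n + 3)) * w n ≤ Real.exp (-(c / (n + 3))) * w n := by
      refine mul_le_mul_of_nonneg_right ?_ (hw0 n)
      have := Real.add_one_le_exp (-(c / ((n : ℝ) + 3)))
      linarith
    refine (max_le ?_ (mul_nonneg hq (hw0 n))).trans hle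
    have h4 : ε n / (n + 3) ≤ c / (n + 3) * (δ / 2) := by
      rw [div_mul_eq_mul_div]
      exact div_le_div_of_nonneg_right h2.le (hpos n).le
    have h5 := mul_le_mul_of_nonneg_left (le_max_left (v n - δ / 2) 0) hq
    simp only [hw]
    linarith
  have hprod : ∀ m : ℕ, w (n₀ + m) ≤
      Real.exp (-(c * ∑ i ∈ Finset.range m, 1 / (((n₀ + i : ℕ) : ℝ) + 3))) * w n₀ := by
    intro m
    induction m with
    | zero => simp
    | succ m ih =>
      refine (hstep (n₀ + m) (Nat.le_add_right _ _)).trans ?_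
      refine (mul_le_mul_of_nonneg_left ih (Real.exp_pos _).le).trans (le_of_eq ?_)
      rw [← mul_assoc, ← Real.exp_add, Finset.sum_range_succ]
      congr 2
      ring
  have hharm : Tendsto (fun m : ℕ => ∑ i ∈ Finset.range m, 1 / (((n₀ + i : ℕ) : ℝ) + 3)) atTop
      atTop := by
    have h1 := Real.tendsto_sum_range_one_div_nat_succ_atTop
    have h2 := (tendsto_atTop_add_const_right atTop
      (-∑ i ∈ Finset.range (n₀ + 2), 1 / ((i : ℝ) + 1)) h1).comp (tendsto_add_atTop_nat (n₀ + 2))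
    refine h2.congr fun m => ?_
    simp only [Function.comp_apply]
    rw [add_comm m, Finset.sum_range_add]
    simp only [add_neg_cancel_comm]
    refine Finset.sum_congr rfl fun i _ => ?_
    push_cast
    congr 1
    ring
  have hlim : Tendsto (fun m : ℕ =>
      Real.exp (-(c * ∑ i ∈ Finset.range m, 1 / (((n₀ + i : ℕ) : ℝ) + 3))) * w n₀) atTop
      (𝓝 (0 * w n₀)) :=
    (Real.tendsto_exp_neg_atTop_nhds_zero.comp (hharm.const_mul_atTop hc)).mul_const _
  rw [zero_mul] at hlim
  obtain ⟨m₀, hm₀⟩ := eventually_atTop.1 (hlim.eventually_lt_const (half_pos hδ))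
  refine eventually_atTop.2 ⟨n₀ + m₀, fun n hn => ?_⟩
  obtain ⟨k, rfl⟩ := Nat.exists_eq_add_of_le hn
  have h1 := (hprod (m₀ + k)).trans_lt (hm₀ _ (Nat.le_add_right _ _))
  rw [← add_assoc] at h1
  have h2 : v (n₀ + m₀ + k) - δ / 2 ≤ w (n₀ + m₀ + k) := le_max_left _ _
  linarith

/-! ### Convergence in probability along the growth -/

section Aas

variable (p : Params)

/-- The filter of the events that hold asymptotically almost surely. For a real function `f` of
the network, `Tendsto f (aas p) (𝓝 L)` says that `f` converges to `L` in probability. -/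
def aas : Filter Network where
  sets := {A | Tendsto (fun n => expect (law p n) (Aᶜ.indicator fun _ => 1)) atTop (𝓝 0)}
  univ_sets := by
    simp [expect]
  sets_of_superset := by
    intro A B hA hAB
    refine squeeze_zero (fun n => expect_nonneg fun x _ => ?_) (fun n => ?_) hA
    · exact Set.indicator_nonneg (fun _ _ => zero_le_one) x
    · refine expect_mono (finite_support_law p n) fun x _ => ?_
      exact Set.indicator_le_indicator_of_subset (Set.compl_subset_compl.2 hAB)
        (fun _ => zero_le_one) x
  inter_sets := by
    intro A B hA hB
    have hAB := hA.add hB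
    rw [add_zero] at hAB
    refine squeeze_zero (fun n => expect_nonneg fun x _ => ?_) (fun n => ?_) hAB
    · exact Set.indicator_nonneg (fun _ _ => zero_le_one) x
    · rw [← expect_add (finite_support_law p n)]
      refine expect_mono (finite_support_law p n) fun x _ => ?_
      by_cases h1 : x ∈ A <;> by_cases h2 : x ∈ B <;> simp [h1, h2]

theorem eventually_aas {P : Network → Prop} {n₀ : ℕ}
    (h : ∀ n, n₀ ≤ n → ∀ N ∈ (law p n).support, P N) : ∀ᶠ N in aas p, P N := by
  refine tendsto_const_nhds.congr' (eventually_atTop.2 ⟨n₀, fun n hn => ?_⟩)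
  rw [← expect_const (finite_support_law p n) 0]
  refine expect_congr fun N hN => ?_
  simp [h n hn N hN]

theorem eventually_regular : ∀ᶠ N in aas p, N.Regular :=
  eventually_aas p (n₀ := 0) fun _ _ _ hN => (law_support p hN).1

/-- Bounded convergence. -/
theorem tendsto_expect {f : Network → ℝ} {B : ℝ} (hB : ∀ N : Network, N.Regular → |f N| ≤ B)
    (hf : Tendsto f (aas p) (𝓝 0)) : Tendsto (fun n => expect (law p n) f) atTop (𝓝 0) := by
  have hB0 : 0 ≤ B := (abs_nonneg _).trans (hB _ regular_init)
  rw [Metric.tendsto_nhds]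
  intro ε hε
  have h1 : {N | |f N| < ε / 2} ∈ aas p := by
    filter_upwards [Metric.tendsto_nhds.1 hf (ε / 2) (half_pos hε)] with N hN
    rwa [Real.dist_eq, sub_zero] at hN
  have h2 : Tendsto (fun n => ε / 2 + B * expect (law p n)
      ({N | |f N| < ε / 2}ᶜ.indicator fun _ => 1)) atTop (𝓝 (ε / 2 + B * 0)) :=
    (Tendsto.const_mul B h1).const_add _
  filter_upwards [h2.eventually_lt_const (show ε / 2 + B * 0 < ε by linarith)] with n hn
  rw [Real.dist_eq, sub_zero]
  refine (abs_expect_le (finite_support_law p n) f).trans_lt (lt_of_le_of_lt ?_ hn)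
  rw [← expect_const_mul, ← expect_const (finite_support_law p n) (ε / 2),
    ← expect_add (finite_support_law p n)]
  refine expect_mono (finite_support_law p n) fun N hN => ?_
  rw [expect_const (finite_support_law p n)]
  by_cases h : |f N| < ε / 2
  · simp [h, h.le]
  · have := hB N (law_support p hN).1
    simp only [Set.indicator, Set.mem_compl_iff, Set.mem_ofPred_eq, h, not_false_eq_true, if_true]
    linarith

/-- Chebyshev's inequality, in the limit. -/
theorem tendsto_of_expect_sq {f : Network → ℝ} {θ : ℝ}
    (h : Tendsto (fun n => expect (law p n) fun N => (f N - θ) ^ 2) atTop (𝓝 0)) :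
    Tendsto f (aas p) (𝓝 θ) := by
  rw [Metric.tendsto_nhds]
  intro ε hε
  have h1 := h.const_mul (1 / ε ^ 2)
  rw [mul_zero] at h1
  refine squeeze_zero (fun n => expect_nonneg fun x _ => ?_) (fun n => ?_) h1
  · exact Set.indicator_nonneg (fun _ _ => zero_le_one) x
  · rw [← expect_const_mul]
    refine expect_mono (finite_support_law p n) fun N _ => ?_
    by_cases hN : dist (f N) θ < ε
    · simp only [Set.indicator, Set.mem_compl_iff, Set.mem_ofPred_eq, hN, not_true, if_false]
      positivity
    · simp only [Set.indicator, Set.mem_compl_iff, Set.mem_ofPred_eq, hN, not_false_eq_true, if_true]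
      rw [not_lt, Real.dist_eq] at hN
      rw [one_div, inv_mul_eq_div, one_le_div (by positivity), ← sq_abs (f N - θ)]
      gcongr

/-- The share `X / t` of a counter `X` that grows by at most one in each step converges in
probability to `θ` if the drift of the share points to `θ`, up to an error that vanishes in
probability. This is a one-dimensional stochastic approximation in mean square. -/
theorem tendsto_share {X : Network → ℝ} {b : Network → Color → Node → ℝ} {err : Network → ℝ}
    {θ c B : ℝ} (hX : ∀ N m g, X (N.addEdge m g) = X N + b N m.color g)
    (hb : ∀ N c g, b N c g ∈ Set.Icc (0 : ℝ) 1)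
    (hXt : ∀ N : Network, N.Regular → X N / N.edges.card ∈ Set.Icc (0 : ℝ) 1)
    (hc : 0 < c) (hB : ∀ N : Network, N.Regular → |err N| ≤ B)
    (herr : Tendsto err (aas p) (𝓝 0))
    (hdrift : ∀ N : Network, N.Regular → (X N / N.edges.card - θ)
      * (expect (stepEdge p N) (fun e => b N e.1.color e.2) - X N / N.edges.card)
      ≤ -c * (X N / N.edges.card - θ) ^ 2 + err N) :
    Tendsto (fun N => X N / N.edges.card) (aas p) (𝓝 θ) := by
  refine tendsto_of_expect_sq p (tendsto_zero_of_contraction (c := 2 * c)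
    (ε := fun n => 2 * expect (law p n) err + 1 / ((n : ℝ) + 1)) (by positivity)
    (fun n => expect_nonneg fun _ _ => sq_nonneg _) ?_ (Eventually.of_forall fun n => ?_))
  · have h := ((tendsto_expect p hB herr).const_mul 2).add
      tendsto_one_div_add_atTop_nhds_zero_nat
    rwa [mul_zero, zero_add] at h
  have hn : (0 : ℝ) < n + 3 := by positivity
  have hfin := finite_support_law p n
  rw [expect_law_succ]
  have key : ∀ N ∈ (law p n).support, expect (stepEdge p N) (fun e =>
      (X (N.addEdge e.1 e.2) / (N.addEdge e.1 e.2).edges.card - θ) ^ 2)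
      ≤ (1 - 2 * c / (n + 3)) * (X N / N.edges.card - θ) ^ 2
        + (2 / (n + 3) * err N + 1 / (n + 3) ^ 2) := by
    intro N hN
    obtain ⟨hreg, hcard⟩ := law_support p hN
    have hfs := finite_support_stepEdge p N
    have hd := hdrift N hreg
    obtain ⟨hx0, hx1⟩ := hXt N hreg
    have ht : (N.edges.card : ℝ) = n + 2 := by rw [hcard]; push_cast; ring
    set x : ℝ := X N / N.edges.card with hx
    have hXx : X N = x * (n + 2) := by
      rw [hx, ht]
      field_simp
    have h1 : ∀ e ∈ (stepEdge p N).support,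
        (X (N.addEdge e.1 e.2) / (N.addEdge e.1 e.2).edges.card - θ) ^ 2
        ≤ ((x - θ) ^ 2 - 2 / (n + 3) * (x - θ) * x + 1 / (n + 3) ^ 2)
          + 2 / (n + 3) * (x - θ) * b N e.1.color e.2 := by
      intro e _
      obtain ⟨hb0, hb1⟩ := hb N e.1.color e.2
      have hcard' : ((N.addEdge e.1 e.2).edges.card : ℝ) = n + 3 := by
        simp only [Network.addEdge, Multiset.card_cons, hcard]
        push_cast
        ring
      rw [hX, hXx, hcard']
      set β := b N e.1.color e.2
      have h2 : (x * (n + 2) + β) / (n + 3) - θ = (x - θ) + (β - x) / (n + 3) := by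
        field_simp
        ring
      have h3 : ((β - x) / (n + 3)) ^ 2 ≤ 1 / ((n : ℝ) + 3) ^ 2 := by
        rw [div_pow]
        refine div_le_div_of_nonneg_right ?_ (by positivity)
        nlinarith
      rw [h2, add_sq]
      have h4 : 2 * (x - θ) * ((β - x) / (n + 3))
          = 2 / (n + 3) * (x - θ) * β - 2 / (n + 3) * (x - θ) * x := by
        ring
      linarith
    refine (expect_mono hfs h1).trans ?_
    rw [expect_add hfs, expect_const hfs, expect_const_mul]
    have h5 := mul_le_mul_of_nonneg_left hd (show (0 : ℝ) ≤ 2 / (n + 3) by positivity)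
    have h6 : 2 * c / ((n : ℝ) + 3) = 2 / (n + 3) * c := by ring
    rw [h6]
    linarith
  refine (expect_mono hfin key).trans ?_
  rw [expect_add hfin, expect_add hfin, expect_const hfin, expect_const_mul, expect_const_mul]
  have h7 : 1 / ((n : ℝ) + 3) ^ 2 ≤ 1 / (n + 1) / (n + 3) := by
    rw [div_div]
    refine one_div_le_one_div_of_le (by positivity) ?_
    nlinarith
  have h8 : 2 * expect (law p n) err / (n + 3) = 2 / (n + 3) * expect (law p n) err := by ring
  rw [add_div, h8]
  linarith

end Aas

/-! ### The limit of the share of the red group sizes -/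

section AlphaStar

variable (p : Params)

/-- The probability that a joining member of color `c` joins a red group, when `x` and `y` are the
shares of the red groups in the group sizes and among the groups. -/
def joinRed (c : Color) (x y : ℝ) : ℝ :=
  (p.xi * acceptP p c .red * x + (1 - p.xi) * acceptU p c .red * y) / roundDen p c x y

/-- The limiting probability that the new edge is at a red group, when `x` is the share of the red
groups in the group sizes. -/
def redDrift (x : ℝ) : ℝ :=
  colorProb p .red * (p.eta + (1 - p.eta) * joinRed p .red x p.r)
    + colorProb p .blue * ((1 - p.eta) * joinRed p .blue x p.r)

theorem roundDen_red (x : ℝ) : roundDen p .red x p.r = denR p x := by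
  simp only [roundDen, denR, acceptP, acceptU, reduceCtorEq, if_true, if_false]
  ring

theorem roundDen_blue (x : ℝ) : roundDen p .blue x p.r = denB p x := by
  simp only [roundDen, denB, acceptP, acceptU, reduceCtorEq, if_true, if_false]
  ring

/-- A lower bound for the acceptance probability of a round, in the limit. -/
def denLower (c : Color) : ℝ := p.xi * p.rhoP c + (1 - p.xi) * colorProb p c

theorem denLower_pos {c : Color} (h : 0 < p.rhoP c) : 0 < denLower p c := by
  obtain ⟨h1, h2⟩ := p.xi_mem
  have h3 := (colorProb_mem p c).1
  unfold denLower
  rcases h1.eq_or_lt with h0 | h0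
  · rw [← h0]
    simpa using h3
  · have := mul_nonneg (sub_nonneg.2 h2) h3.le
    have := mul_pos h0 h
    linarith

theorem denLower_le (c : Color) {x : ℝ} (hx : x ∈ Set.Icc (0 : ℝ) 1) :
    denLower p c ≤ roundDen p c x p.r := by
  obtain ⟨h1, h2⟩ := p.xi_mem
  obtain ⟨h3, h4⟩ := r_mem_Icc p
  obtain ⟨h5, h6⟩ := p.rhoP_mem c
  obtain ⟨h7, h8⟩ := p.rhoU_mem c
  obtain ⟨hx0, hx1⟩ := hx
  have h1' := sub_nonneg.2 h2
  have hx1' := sub_nonneg.2 hx1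
  have h4' := sub_nonneg.2 h4
  have h6' := sub_nonneg.2 h6
  cases c
  · have : roundDen p .red x p.r - denLower p .red
        = p.xi * (x * (1 - p.rhoP .red)) + (1 - p.xi) * (p.rhoU .red * (1 - p.r)) := by
      simp only [roundDen, denLower, colorProb, acceptP, acceptU, reduceCtorEq, if_true, if_false]
      ring
    rw [← sub_nonneg, this]
    positivity
  · have : roundDen p .blue x p.r - denLower p .blue
        = p.xi * ((1 - x) * (1 - p.rhoP .blue)) + (1 - p.xi) * (p.rhoU .blue * p.r) := by
      simp only [roundDen, denLower, colorProb, acceptP, acceptU, reduceCtorEq, if_true, if_false]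
      ring
    rw [← sub_nonneg, this]
    positivity

theorem roundDen_le_one (c : Color) {x y : ℝ} (hx : x ∈ Set.Icc (0 : ℝ) 1)
    (hy : y ∈ Set.Icc (0 : ℝ) 1) : roundDen p c x y ≤ 1 := by
  obtain ⟨h1, h2⟩ := p.xi_mem
  have hmix : ∀ {u v z : ℝ}, u ≤ 1 → v ≤ 1 → z ∈ Set.Icc (0 : ℝ) 1 → u * z + v * (1 - z) ≤ 1 := by
    rintro u v z hu hv ⟨hz0, hz1⟩
    nlinarith
  have h3 := hmix (acceptP_mem p c .red).2 (acceptP_mem p c .blue).2 hx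
  have h4 := hmix (acceptU_mem p c .red).2 (acceptU_mem p c .blue).2 hy
  have := hmix h3 h4 p.xi_mem
  unfold roundDen
  linarith

variable {p}

theorem roundDen_pos (hρ : ∀ c, 0 < p.rhoP c) (c : Color) {x : ℝ} (hx : x ∈ Set.Icc (0 : ℝ) 1) :
    0 < roundDen p c x p.r :=
  (denLower_pos p (hρ c)).trans_le (denLower_le p c hx)

variable (p)

/-- The numerator of `redDrift p x - x` over the common denominator, a cubic polynomial. -/
def driftCubic (x : ℝ) : ℝ :=
  (p.r * p.eta - x) * (denR p x * denB p x)
    + p.r * (1 - p.eta) * (p.xi * x + (1 - p.xi) * p.r) * denB p x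
    + (1 - p.r) * (1 - p.eta) * (p.rhoP .blue * p.xi * x + p.rhoU .blue * (1 - p.xi) * p.r)
      * denR p x

variable {p}

theorem redDrift_eq (x : ℝ) : redDrift p x = p.r * p.eta
      + p.r * (1 - p.eta) * (p.xi * x + (1 - p.xi) * p.r) / denR p x
      + (1 - p.r) * (1 - p.eta) * (p.rhoP .blue * p.xi * x + p.rhoU .blue * (1 - p.xi) * p.r)
        / denB p x := by
  simp only [redDrift, joinRed, roundDen_red, roundDen_blue, colorProb, acceptP, acceptU,
    reduceCtorEq, if_true, if_false]
  ring

theorem driftCubic_eq (hρ : ∀ c, 0 < p.rhoP c) {x : ℝ} (hx : x ∈ Set.Icc (0 : ℝ) 1) :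
    driftCubic p x = (redDrift p x - x) * (denR p x * denB p x) := by
  have hR := (roundDen_pos hρ .red hx).ne'
  have hB := (roundDen_pos hρ .blue hx).ne'
  rw [roundDen_red] at hR
  rw [roundDen_blue] at hB
  rw [redDrift_eq, driftCubic]
  field_simp
  ring

theorem isAlphaStar_iff (hρ : ∀ c, 0 < p.rhoP c) (a : ℝ) :
    IsAlphaStar p a ↔ a ∈ Set.Ioo (0 : ℝ) 1 ∧ driftCubic p a = 0 := by
  rw [IsAlphaStar, ← redDrift_eq]
  refine and_congr_right fun ha => ?_
  have ha' := Set.Ioo_subset_Icc_self ha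
  have hR := (roundDen_pos hρ .red ha').ne'
  have hB := (roundDen_pos hρ .blue ha').ne'
  rw [roundDen_red] at hR
  rw [roundDen_blue] at hB
  rw [driftCubic_eq hρ ha', mul_eq_zero, or_iff_left (mul_ne_zero hR hB), sub_eq_zero, eq_comm]

theorem driftCubic_zero_pos (hρ : ∀ c, 0 < p.rhoP c) : 0 < driftCubic p 0 := by
  have h0 : (0 : ℝ) ∈ Set.Icc (0 : ℝ) 1 := by simp
  have hR := roundDen_pos hρ .red h0
  have hB := roundDen_pos hρ .blue h0
  rw [roundDen_red] at hR
  rw [roundDen_blue] at hB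
  obtain ⟨h1, h2⟩ := p.xi_mem
  obtain ⟨h3, h4⟩ := p.eta_mem
  have h5 := p.r_mem.1
  have h6 := sub_nonneg.2 (r_mem_Icc p).2
  have h7 := (p.rhoU_mem .blue).1
  have h2' := sub_nonneg.2 h2
  have h4' := sub_pos.2 h4
  simp only [driftCubic, mul_zero, zero_add, sub_zero]
  positivity

theorem driftCubic_one_neg (hρ : ∀ c, 0 < p.rhoP c) : driftCubic p 1 < 0 := by
  have h0 : (1 : ℝ) ∈ Set.Icc (0 : ℝ) 1 := by simp
  have hR := roundDen_pos hρ .red h0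
  have hB := roundDen_pos hρ .blue h0
  rw [roundDen_red] at hR
  rw [roundDen_blue] at hB
  obtain ⟨h1, h2⟩ := p.xi_mem
  obtain ⟨h3, h4⟩ := p.eta_mem
  have h5 := p.r_mem.1
  have h6 := (colorProb_mem p .blue).1
  simp only [colorProb] at h6
  have h7 := (p.rhoU_mem .red).1
  have h2' := sub_nonneg.2 h2
  have h4' := sub_pos.2 h4
  -- The probability that the new edge is at a blue group, over the common denominator.
  have : -driftCubic p 1 = (1 - p.r) * p.eta * (denR p 1 * denB p 1)
      + p.r * (1 - p.eta) * (p.rhoU .red * (1 - p.xi) * (1 - p.r)) * denB p 1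
      + (1 - p.r) * (1 - p.eta) * ((1 - p.xi) * (1 - p.r)) * denR p 1 := by
    simp only [driftCubic, denR, denB]
    ring
  rw [← neg_pos, this]
  positivity

/-- The cubic `driftCubic p` has a nonnegative leading coefficient, is positive at `0`, and is
negative at `1`. Its quotient by `x - a`, for a root `a` in `(0, 1)`, is therefore a convex
quadratic that is negative at `0` and `1`, hence negative in between. -/
theorem driftCubic_factor (hρ : ∀ c, 0 < p.rhoP c) {a : ℝ} (ha : a ∈ Set.Ioo (0 : ℝ) 1)
    (h : driftCubic p a = 0) : ∃ δ > 0, ∀ x ∈ Set.Icc (0 : ℝ) 1, ∃ q ≤ -δ,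
      driftCubic p x = (x - a) * q := by
  obtain ⟨ha0, ha1⟩ := ha
  obtain ⟨A, B, C, D, hA, hcubic⟩ : ∃ A B C D : ℝ, 0 ≤ A ∧
      ∀ x, driftCubic p x = A * x ^ 3 + B * x ^ 2 + C * x + D := by
    obtain ⟨h1, h2⟩ := p.xi_mem
    -- `denR p x = u + s x` and `denB p x = w - v x`
    set s := (1 - p.rhoP .red) * p.xi with hs
    set v := (1 - p.rhoP .blue) * p.xi with hv
    set u := 1 - s - (1 - p.rhoU .red) * (1 - p.xi) * (1 - p.r) with hu
    set w := 1 - (1 - p.rhoU .blue) * (1 - p.xi) * p.r with hw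
    have hs0 : 0 ≤ s := mul_nonneg (sub_nonneg.2 (p.rhoP_mem _).2) h1
    have hv0 : 0 ≤ v := mul_nonneg (sub_nonneg.2 (p.rhoP_mem _).2) h1
    have hR : ∀ x, denR p x = u + s * x := fun x => by
      rw [hu, hs, denR]
      ring
    have hB : ∀ x, denB p x = w - v * x := fun x => by
      rw [hw, hv, denB]
      ring
    set e := p.r * p.eta
    set f := p.r * (1 - p.eta)
    set g := (1 - p.r) * (1 - p.eta)
    set i := (1 - p.xi) * p.r
    set j := p.rhoP .blue * p.xi
    set k := p.rhoU .blue * (1 - p.xi) * p.r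
    refine ⟨s * v, -(s * w - u * v) - e * s * v - f * p.xi * v + g * j * s,
      -(u * w) + e * (s * w - u * v) + f * (p.xi * w - i * v) + g * (j * u + k * s),
      e * u * w + f * i * w + g * k * u, mul_nonneg hs0 hv0, fun x => ?_⟩
    simp only [driftCubic, hR, hB]
    ring
  have h0 := driftCubic_zero_pos hρ
  have h1 := driftCubic_one_neg hρ
  rw [hcubic] at h h0 h1
  set q : ℝ → ℝ := fun x => A * x ^ 2 + (A * a + B) * x + (A * a ^ 2 + B * a + C) with hq
  have hfac : ∀ x, driftCubic p x = (x - a) * q x := by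
    intro x
    rw [hcubic, hq]
    linear_combination h
  have hq0 : q 0 < 0 := by
    have := hfac 0
    rw [hcubic] at this
    by_contra hcon
    nlinarith
  have hq1 : q 1 < 0 := by
    have := hfac 1
    rw [hcubic] at this
    by_contra hcon
    nlinarith
  refine ⟨min (-q 0) (-q 1), lt_min (neg_pos.2 hq0) (neg_pos.2 hq1), fun x hx =>
    ⟨q x, ?_, hfac x⟩⟩
  obtain ⟨hx0, hx1⟩ := hx
  have hconv : q x ≤ (1 - x) * q 0 + x * q 1 := by
    have h2 : (1 - x) * q 0 + x * q 1 - q x = A * (x * (1 - x)) := by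
      simp only [hq]
      ring
    have h3 := mul_nonneg hA (mul_nonneg hx0 (sub_nonneg.2 hx1))
    linarith
  have h4 := mul_le_mul_of_nonneg_left (min_le_left (-q 0) (-q 1)) (sub_nonneg.2 hx1)
  have h5 := mul_le_mul_of_nonneg_left (min_le_right (-q 0) (-q 1)) hx0
  linarith

theorem existsUnique_alphaStar (hρ : ∀ c, 0 < p.rhoP c) : ∃! a : ℝ, IsAlphaStar p a := by
  have hcont : Continuous (driftCubic p) := by
    unfold driftCubic denR denB
    fun_prop
  obtain ⟨a, ha, h0⟩ := intermediate_value_Ioo' zero_le_one hcont.continuousOn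
    ⟨driftCubic_one_neg hρ, driftCubic_zero_pos hρ⟩
  refine ⟨a, (isAlphaStar_iff hρ a).2 ⟨ha, h0⟩, fun b hb => ?_⟩
  obtain ⟨hb, hb0⟩ := (isAlphaStar_iff hρ b).1 hb
  obtain ⟨δ, hδ, h⟩ := driftCubic_factor hρ ha h0
  obtain ⟨q, hq, hbq⟩ := h b (Set.Ioo_subset_Icc_self hb)
  rw [hb0, eq_comm, mul_eq_zero, or_iff_left (by linarith)] at hbq
  exact sub_eq_zero.1 hbq

theorem redDrift_contracts (hρ : ∀ c, 0 < p.rhoP c) {a : ℝ} (ha : IsAlphaStar p a) :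
    ∃ δ > 0, ∀ x ∈ Set.Icc (0 : ℝ) 1, (x - a) * (redDrift p x - x) ≤ -δ * (x - a) ^ 2 := by
  obtain ⟨ha, h0⟩ := (isAlphaStar_iff hρ a).1 ha
  obtain ⟨δ, hδ, h⟩ := driftCubic_factor hρ ha h0
  refine ⟨δ, hδ, fun x hx => ?_⟩
  obtain ⟨q, hq, hxq⟩ := h x hx
  have hR := roundDen_pos hρ .red hx
  have hB := roundDen_pos hρ .blue hx
  have hR1 := roundDen_le_one p .red hx (r_mem_Icc p)
  have hB1 := roundDen_le_one p .blue hx (r_mem_Icc p)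
  rw [roundDen_red] at hR hR1
  rw [roundDen_blue] at hB hB1
  rw [driftCubic_eq hρ hx, ← eq_div_iff (mul_pos hR hB).ne'] at hxq
  have hden : denR p x * denB p x ≤ 1 := mul_le_one₀ hR1 hB.le hB1
  have h2 : q / (denR p x * denB p x) ≤ -δ := by
    rw [div_le_iff₀ (mul_pos hR hB)]
    nlinarith
  rw [hxq, mul_div_assoc, ← mul_assoc, ← sq, mul_comm (-δ)]
  exact mul_le_mul_of_nonneg_left h2 (sq_nonneg _)

end AlphaStar

/-! ### The limits of the shares -/

section Shares

variable (p : Params)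

theorem expect_stepEdge_memberColor (N : Network) (φ : Color → ℝ) :
    expect (stepEdge p N) (fun e => φ e.1.color)
      = actorProb p N .red * φ .red + actorProb p N .blue * φ .blue := by
  rw [expect_stepEdge p N fun c _ => φ c]
  simp only [expect_const (finite_support_joinStep p N _)]
  ring

theorem tendsto_memberShare : Tendsto (fun N => memberShare N .red) (aas p) (𝓝 p.r) := by
  have hX : ∀ (N : Network) (m g : Node),
      (((N.addEdge m g).edges.countP fun e => e.1.color = .red : ℕ) : ℝ)
        = (N.edges.countP fun e => e.1.color = .red : ℕ)
          + if m.color = .red then 1 else 0 := by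
    intro N m g
    rw [Network.addEdge, Multiset.countP_cons]
    push_cast
    rfl
  have hb : ∀ (_ : Network) (c : Color) (_ : Node),
      (if c = .red then (1 : ℝ) else 0) ∈ Set.Icc (0 : ℝ) 1 := by
    intro _ c _
    split_ifs <;> simp
  have hdrift : ∀ N : Network, N.Regular → (memberShare N .red - p.r)
      * (expect (stepEdge p N) (fun e => if e.1.color = .red then 1 else 0) - memberShare N .red)
      ≤ -p.alpha * (memberShare N .red - p.r) ^ 2 + 0 := by
    intro N _
    rw [expect_stepEdge_memberColor p N fun c => if c = .red then 1 else 0]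
    simp only [actorProb, colorProb, reduceCtorEq, if_true, if_false]
    exact le_of_eq (by ring)
  have h := tendsto_share p (b := fun _ c _ => if c = .red then 1 else 0) (err := fun _ => 0)
    (B := 0) hX hb (fun N _ => memberShare_mem N .red) p.alpha_mem.1 (by simp)
    tendsto_const_nhds hdrift
  exact h

theorem tendsto_actorProb (c : Color) :
    Tendsto (fun N => actorProb p N c) (aas p) (𝓝 (colorProb p c)) := by
  have hred : Tendsto (fun N => actorProb p N .red) (aas p) (𝓝 p.r) := by
    have h := ((tendsto_memberShare p).const_mul (1 - p.alpha)).const_add (p.alpha * p.r)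
    have h2 : p.alpha * p.r + (1 - p.alpha) * p.r = p.r := by ring
    rwa [h2] at h
  cases c
  · exact hred
  · simp only [actorProb_blue]
    exact hred.const_sub 1

/-- A created group is new, and a joined group is not. -/
theorem expect_stepEdge_new {N : Network} (hN : N.Regular) (φ : Color → ℝ) :
    expect (stepEdge p N) (fun e => if e.2 ∈ N.groups then 0 else φ e.2.color)
      = p.eta * (actorProb p N .red * φ .red + actorProb p N .blue * φ .blue) := by
  have h0 : ∀ c, expect (joinStep p N c) (fun g => if g ∈ N.groups then 0 else φ g.color) = 0 := by
    intro c
    refine (expect_congr fun g hg => ?_).trans (expect_const (finite_support_joinStep p N c) 0)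
    exact if_pos (mem_groups_of_mem_joinStep p hN hg)
  rw [expect_stepEdge p N fun _ g => if g ∈ N.groups then 0 else φ g.color, h0, h0,
    if_neg (hN.new_notMem _), if_neg (hN.new_notMem _)]
  ring

theorem card_filter_insert {α : Type*} [DecidableEq α] (s : Finset α) (P : α → Prop)
    [DecidablePred P] (g : α) : (((insert g s).filter P).card : ℝ)
      = (s.filter P).card + if g ∈ s then 0 else if P g then 1 else 0 := by
  by_cases hg : g ∈ s
  · simp [hg, Finset.insert_eq_of_mem]
  · rw [Finset.filter_insert, if_neg hg]
    by_cases hP : P g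
    · rw [if_pos hP, if_pos hP, Finset.card_insert_of_notMem (by simp [hg])]
      push_cast
      rfl
    · simp [hP]

theorem tendsto_card_groups :
    Tendsto (fun N => (N.groups.card : ℝ) / N.edges.card) (aas p) (𝓝 p.eta) := by
  refine tendsto_share p (X := fun N => (N.groups.card : ℝ))
    (b := fun N _ g => if g ∈ N.groups then 0 else 1) (err := fun _ => 0) (c := 1) (B := 0)
    ?_ ?_ (fun N hN => ⟨by positivity, div_le_one_of_le₀ (by exact_mod_cast hN.card_groups_le)
      (Nat.cast_nonneg _)⟩) one_pos (by simp) tendsto_const_nhds ?_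
  · intro N m g
    simpa [Network.addEdge] using card_filter_insert N.groups (fun _ => True) g
  · intro N c g
    split_ifs <;> simp
  · intro N hN
    rw [expect_stepEdge_new p hN fun _ => 1, actorProb_blue]
    exact le_of_eq (by ring)

theorem tendsto_card_redGroups :
    Tendsto (fun N => ((N.groups.filter fun g => g.color = .red).card : ℝ) / N.edges.card) (aas p)
      (𝓝 (p.eta * p.r)) := by
  have hle : ∀ N : Network, N.Regular →
      ((N.groups.filter fun g => g.color = .red).card : ℝ) / N.edges.card ∈ Set.Icc (0 : ℝ) 1 :=
    fun N hN => ⟨by positivity, div_le_one_of_le₀ (by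
      exact_mod_cast (Finset.card_filter_le _ _).trans hN.card_groups_le) (Nat.cast_nonneg _)⟩
  refine tendsto_share p (X := fun N => ((N.groups.filter fun g => g.color = .red).card : ℝ))
    (b := fun N _ g => if g ∈ N.groups then 0 else if g.color = .red then 1 else 0)
    (err := fun N => |actorProb p N .red - p.r|) (c := 1) (B := 1)
    ?_ ?_ hle one_pos ?_ ?_ ?_
  · exact fun N m g => card_filter_insert N.groups _ g
  · intro N c g
    split_ifs <;> simp
  · intro N _
    obtain ⟨h1, h2⟩ := actorProb_mem p N .red
    obtain ⟨h3, h4⟩ := r_mem_Icc p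
    rw [abs_abs, abs_le]
    constructor <;> linarith
  · have h := ((tendsto_actorProb p .red).sub_const p.r).abs
    simpa [colorProb] using h
  · intro N hN
    obtain ⟨h1, h2⟩ := hle N hN
    obtain ⟨h3, h4⟩ := r_mem_Icc p
    obtain ⟨h5, h6⟩ := eta_mem_Icc p
    rw [expect_stepEdge_new p hN fun C => if C = .red then 1 else 0]
    simp only [reduceCtorEq, if_true, if_false, mul_one, mul_zero, add_zero]
    set x : ℝ := ((N.groups.filter fun g => g.color = .red).card : ℝ) / N.edges.card
    set P := actorProb p N .red
    have h7 : |(x - p.eta * p.r) * p.eta| ≤ 1 := by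
      have h8 : p.eta * p.r ∈ Set.Icc (0 : ℝ) 1 :=
        ⟨mul_nonneg h5 h3, mul_le_one₀ h6 h3 h4⟩
      rw [abs_mul, abs_of_nonneg h5]
      refine mul_le_one₀ ?_ h5 h6
      rw [abs_le]
      constructor <;> linarith [h8.1, h8.2]
    have h9 : (x - p.eta * p.r) * p.eta * (P - p.r) ≤ |P - p.r| := by
      refine (le_abs_self _).trans ?_
      rw [abs_mul]
      exact mul_le_of_le_one_left (abs_nonneg _) h7
    nlinarith

theorem tendsto_groupShare : Tendsto (fun N => groupShare N .red) (aas p) (𝓝 p.r) := by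
  have h := (tendsto_card_redGroups p).div (tendsto_card_groups p) p.eta_mem.1.ne'
  rw [mul_div_cancel_left₀ _ p.eta_mem.1.ne'] at h
  refine h.congr fun N => ?_
  have := (card_edges_pos N).ne'
  simp only [groupShare, Pi.div_apply]
  rw [div_div_div_cancel_right₀ this]

theorem roundDen_sub_numerator (c : Color) (x y : ℝ) :
    roundDen p c x y - (p.xi * acceptP p c .red * x + (1 - p.xi) * acceptU p c .red * y)
      = p.xi * acceptP p c .blue * (1 - x) + (1 - p.xi) * acceptU p c .blue * (1 - y) := by
  rw [roundDen]
  ring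

theorem joinRed_numerator_mem (c : Color) {x y : ℝ} (hx : x ∈ Set.Icc (0 : ℝ) 1)
    (hy : y ∈ Set.Icc (0 : ℝ) 1) :
    p.xi * acceptP p c .red * x + (1 - p.xi) * acceptU p c .red * y
      ∈ Set.Icc 0 (roundDen p c x y) := by
  have h1 := p.xi_mem.1
  have h2 := sub_nonneg.2 p.xi_mem.2
  have h3 := sub_nonneg.2 hx.2
  have h4 := sub_nonneg.2 hy.2
  have h5 := fun C => (acceptP_mem p c C).1
  have h6 := fun C => (acceptU_mem p c C).1
  constructor
  · have := mul_nonneg (mul_nonneg h1 (h5 .red)) hx.1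
    have := mul_nonneg (mul_nonneg h2 (h6 .red)) hy.1
    linarith
  · rw [← sub_nonneg, roundDen_sub_numerator]
    have := mul_nonneg (mul_nonneg h1 (h5 .blue)) h3
    have := mul_nonneg (mul_nonneg h2 (h6 .blue)) h4
    linarith

theorem joinRed_mem (c : Color) {x y : ℝ} (hx : x ∈ Set.Icc (0 : ℝ) 1)
    (hy : y ∈ Set.Icc (0 : ℝ) 1) : joinRed p c x y ∈ Set.Icc (0 : ℝ) 1 := by
  obtain ⟨h1, h2⟩ := joinRed_numerator_mem p c hx hy
  exact ⟨div_nonneg h1 (h1.trans h2), div_le_one_of_le₀ h2 (h1.trans h2)⟩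

theorem expect_joinStep_red (N : Network) (c : Color) :
    expect (joinStep p N c) (fun g => if g.color = .red then 1 else 0)
      = joinRed p c (edgeShare N .red) (groupShare N .red) := by
  rw [expect_joinStep, acceptMean_one, acceptMean_color p N c fun C => if C = .red then 1 else 0,
    joinRed]
  simp only [reduceCtorEq, if_true, if_false]
  ring

variable {p}

/-- The probability `joinRed p c x y` is Lipschitz at `y = p.r`, uniformly in `x`. The bound holds
for all `y`, although the denominator may come close to `0` away from `y = p.r`. -/
theorem abs_joinRed_sub_le (hρ : ∀ c, 0 < p.rhoP c) (c : Color) {x y : ℝ}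
    (hx : x ∈ Set.Icc (0 : ℝ) 1) (hy : y ∈ Set.Icc (0 : ℝ) 1) :
    |joinRed p c x y - joinRed p c x p.r| ≤ 2 / denLower p c * |y - p.r| := by
  have hd := denLower_pos p (hρ c)
  have hD := roundDen_pos hρ c hx
  obtain ⟨hJ0, hJ1⟩ := joinRed_mem p c hx hy
  have hA : joinRed p c x y * roundDen p c x y
      = p.xi * acceptP p c .red * x + (1 - p.xi) * acceptU p c .red * y := by
    obtain ⟨h1, h2⟩ := joinRed_numerator_mem p c hx hy
    by_cases h0 : roundDen p c x y = 0
    · rw [h0] at h2 ⊢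
      rw [mul_zero]
      exact le_antisymm h1 h2
    · rw [joinRed, div_mul_cancel₀ _ h0]
  have hA' : joinRed p c x p.r * roundDen p c x p.r
      = p.xi * acceptP p c .red * x + (1 - p.xi) * acceptU p c .red * p.r := by
    rw [joinRed, div_mul_cancel₀ _ hD.ne']
  set J := joinRed p c x y
  have hdiff : (J - joinRed p c x p.r) * roundDen p c x p.r
      = (1 - p.xi) * (acceptU p c .red - J * (acceptU p c .red - acceptU p c .blue))
        * (y - p.r) := by
    have h3 : roundDen p c x p.r = roundDen p c x y
        - (1 - p.xi) * (acceptU p c .red - acceptU p c .blue) * (y - p.r) := by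
      simp only [roundDen]
      ring
    rw [sub_mul, hA', h3, mul_sub, hA]
    ring
  have h1 := p.xi_mem.1
  have h2 := p.xi_mem.2
  obtain ⟨hr0, hr1⟩ := acceptU_mem p c .red
  obtain ⟨hb0, hb1⟩ := acceptU_mem p c .blue
  have hcoef : |(1 - p.xi) * (acceptU p c .red - J * (acceptU p c .red - acceptU p c .blue))|
      ≤ 2 := by
    have h4 : |acceptU p c .red - acceptU p c .blue| ≤ 1 := by
      rw [abs_le]
      constructor <;> linarith
    have h5 : |J * (acceptU p c .red - acceptU p c .blue)| ≤ 1 := by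
      rw [abs_mul, abs_of_nonneg hJ0]
      exact mul_le_one₀ hJ1 (abs_nonneg _) h4
    have h6 : |acceptU p c .red - J * (acceptU p c .red - acceptU p c .blue)| ≤ 2 := by
      rw [abs_le] at h5 ⊢
      constructor <;> linarith [h5.1, h5.2]
    rw [abs_mul, abs_of_nonneg (sub_nonneg.2 h2)]
    calc _ ≤ 1 * 2 := mul_le_mul (by linarith) h6 (abs_nonneg _) zero_le_one
      _ = 2 := one_mul 2
  have h7 : |J - joinRed p c x p.r| * roundDen p c x p.r ≤ 2 * |y - p.r| := by
    have h8 := abs_mul (J - joinRed p c x p.r) (roundDen p c x p.r)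
    rw [abs_of_pos hD] at h8
    rw [← h8, hdiff, abs_mul]
    exact mul_le_mul_of_nonneg_right hcoef (abs_nonneg _)
  rw [div_mul_eq_mul_div, le_div_iff₀ hd]
  exact (mul_le_mul_of_nonneg_left (denLower_le p c hx) (abs_nonneg _)).trans h7

theorem tendsto_edgeShare (hρ : ∀ c, 0 < p.rhoP c) {a : ℝ} (ha : IsAlphaStar p a) :
    Tendsto (fun N => edgeShare N .red) (aas p) (𝓝 a) := by
  obtain ⟨δ, hδ, hcontr⟩ := redDrift_contracts hρ ha
  have ha01 := Set.Ioo_subset_Icc_self ha.1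
  have hdR := denLower_pos p (hρ .red)
  have hdB := denLower_pos p (hρ .blue)
  set κ := 2 / denLower p .red + 2 / denLower p .blue with hκ
  have hκ0 : 0 ≤ κ := by positivity
  refine tendsto_share p (X := fun N => (N.edges.countP fun e => e.2.color = .red : ℕ))
    (b := fun _ _ g => if g.color = .red then 1 else 0)
    (err := fun N => 2 * |actorProb p N .red - p.r| + κ * |groupShare N .red - p.r|)
    (c := δ) (B := 2 + κ) ?_ ?_ (fun N _ => edgeShare_mem N .red) hδ ?_ ?_ ?_
  · intro N m g
    rw [Network.addEdge, Multiset.countP_cons]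
    push_cast
    rfl
  · intro N c g
    split_ifs <;> simp
  · intro N _
    obtain ⟨h1, h2⟩ := actorProb_mem p N .red
    obtain ⟨h3, h4⟩ := r_mem_Icc p
    obtain ⟨h5, h6⟩ := groupShare_mem N .red
    have h7 : |actorProb p N .red - p.r| ≤ 1 := abs_le.2 ⟨by linarith, by linarith⟩
    have h8 : |groupShare N .red - p.r| ≤ 1 := abs_le.2 ⟨by linarith, by linarith⟩
    rw [abs_of_nonneg (by positivity)]
    have := mul_le_mul_of_nonneg_left h8 hκ0
    linarith
  · have h1 := ((tendsto_actorProb p .red).sub_const p.r).abs.const_mul 2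
    have h2 := ((tendsto_groupShare p).sub_const p.r).abs.const_mul κ
    have h := h1.add h2
    simpa [colorProb] using h
  · intro N _
    have hx := edgeShare_mem N .red
    have hy := groupShare_mem N .red
    change (edgeShare N .red - a) * (_ - edgeShare N .red) ≤ -δ * (edgeShare N .red - a) ^ 2 + _
    rw [expect_stepEdge p N fun _ g => if g.color = .red then 1 else 0, expect_joinStep_red,
      expect_joinStep_red, actorProb_blue]
    simp only [reduceCtorEq, if_true, if_false, mul_one, mul_zero, zero_add]
    set x := edgeShare N .red
    set y := groupShare N .red
    set P := actorProb p N .red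
    have hc := hcontr x hx
    have hR := abs_joinRed_sub_le hρ .red hx hy
    have hB := abs_joinRed_sub_le hρ .blue hx hy
    obtain ⟨hJ0, hJ1⟩ := joinRed_mem p .red hx hy
    obtain ⟨hK0, hK1⟩ := joinRed_mem p .blue hx hy
    obtain ⟨h1, h2⟩ := eta_mem_Icc p
    obtain ⟨h3, h4⟩ := r_mem_Icc p
    set J := joinRed p .red x y
    set K := joinRed p .blue x y
    set ΔR := J - joinRed p .red x p.r with hΔR
    set ΔB := K - joinRed p .blue x p.r with hΔB
    have hdiff : P * (p.eta + (1 - p.eta) * J) + (1 - P) * ((1 - p.eta) * K)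
        = redDrift p x + (P - p.r) * (p.eta + (1 - p.eta) * J - (1 - p.eta) * K)
          + (p.r * (1 - p.eta) * ΔR + (1 - p.r) * (1 - p.eta) * ΔB) := by
      simp only [redDrift, colorProb, hΔR, hΔB]
      ring
    have h2' := sub_nonneg.2 h2
    have h4' := sub_nonneg.2 h4
    have hcJ : |p.eta + (1 - p.eta) * J - (1 - p.eta) * K| ≤ 2 := by
      have := mul_nonneg h2' hJ0
      have := mul_nonneg h2' hK0
      have := mul_le_of_le_one_right h2' hJ1
      have := mul_le_of_le_one_right h2' hK1
      rw [abs_le]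
      constructor <;> linarith
    have hcR : |p.r * (1 - p.eta)| ≤ 1 := by
      rw [abs_of_nonneg (mul_nonneg h3 h2')]
      exact mul_le_one₀ h4 h2' (by linarith)
    have hcB : |(1 - p.r) * (1 - p.eta)| ≤ 1 := by
      rw [abs_of_nonneg (mul_nonneg h4' h2')]
      exact mul_le_one₀ (by linarith) h2' (by linarith)
    have hxa : |x - a| ≤ 1 :=
      abs_le.2 ⟨by linarith [hx.1, ha01.2], by linarith [hx.2, ha01.1]⟩
    have herr : |(P - p.r) * (p.eta + (1 - p.eta) * J - (1 - p.eta) * K)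
          + (p.r * (1 - p.eta) * ΔR + (1 - p.r) * (1 - p.eta) * ΔB)|
        ≤ 2 * |P - p.r| + κ * |y - p.r| := by
      refine (abs_add_le _ _).trans (add_le_add ?_ ((abs_add_le _ _).trans ?_))
      · rw [abs_mul, mul_comm]
        exact mul_le_mul_of_nonneg_right hcJ (abs_nonneg _)
      · rw [abs_mul, abs_mul _ ΔB, hκ, add_mul]
        exact add_le_add ((mul_le_of_le_one_left (abs_nonneg _) hcR).trans hR)
          ((mul_le_of_le_one_left (abs_nonneg _) hcB).trans hB)
    rw [hdiff]
    set E := (P - p.r) * (p.eta + (1 - p.eta) * J - (1 - p.eta) * K)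
          + (p.r * (1 - p.eta) * ΔR + (1 - p.r) * (1 - p.eta) * ΔB) with hE
    have hfin : (x - a) * E ≤ 2 * |P - p.r| + κ * |y - p.r| := by
      refine (le_abs_self _).trans ?_
      rw [abs_mul]
      exact (mul_le_of_le_one_left (abs_nonneg _) hxa).trans herr
    have hsplit : (x - a) * (redDrift p x
        + (P - p.r) * (p.eta + (1 - p.eta) * J - (1 - p.eta) * K)
          + (p.r * (1 - p.eta) * ΔR + (1 - p.r) * (1 - p.eta) * ΔB) - x)
        = (x - a) * (redDrift p x - x) + (x - a) * E := by
      rw [hE]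
      ring
    rw [hsplit]
    linarith

end Shares

/-! ### The recursion for the expected numbers of groups -/

section Master

open Classical in
/-- The indicator of the event that `g` is a group of color `C` and size `k`. -/
def groupInd (N : Network) (C : Color) (k : ℕ) (g : Node) : ℝ :=
  if g ∈ N.groups ∧ g.color = C ∧ N.groupSize g = k then 1 else 0

theorem groupCount_eq_sum (N : Network) (C : Color) (k : ℕ) :
    (N.groupCount C k : ℝ)
      = ∑ h ∈ N.groups, if h.color = C ∧ N.groupSize h = k then 1 else 0 := by
  rw [Network.groupCount, Finset.sum_boole]

theorem groupSize_addEdge (N : Network) (m g h : Node) :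
    (N.addEdge m g).groupSize h = N.groupSize h + if h = g then 1 else 0 := by
  simp only [Network.groupSize, Network.addEdge, Multiset.map_cons, Multiset.count_cons]

theorem Network.Regular.groupCount_zero {N : Network} (hN : N.Regular) (C : Color) :
    N.groupCount C 0 = 0 := by
  rw [Network.groupCount, Finset.card_eq_zero, Finset.filter_eq_empty_iff]
  intro g hg h
  exact (hN.groupSize_pos hg).ne' h.2

theorem Network.Regular.groupCount_addEdge {N : Network} (hN : N.Regular) (m g : Node)
    (C : Color) (k : ℕ) : ((N.addEdge m g).groupCount C (k + 1) : ℝ)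
      = N.groupCount C (k + 1) + (if g ∈ N.groups then 0 else if g.color = C ∧ k = 0 then 1 else 0)
        + groupInd N C k g - groupInd N C (k + 1) g := by
  rw [groupCount_eq_sum, groupCount_eq_sum]
  have hne : ∀ h, h ≠ g → (N.addEdge m g).groupSize h = N.groupSize h := fun h hh => by
    rw [groupSize_addEdge, if_neg hh, add_zero]
  have hg : (N.addEdge m g).groupSize g = N.groupSize g + 1 := by
    rw [groupSize_addEdge, if_pos rfl]
  by_cases hmem : g ∈ N.groups
  · have hgr : (N.addEdge m g).groups = N.groups := Finset.insert_eq_of_mem hmem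
    rw [hgr, ← Finset.add_sum_erase _ _ hmem, ← Finset.add_sum_erase N.groups _ hmem, hg,
      Finset.sum_congr rfl fun h hh => by rw [hne h (Finset.ne_of_mem_erase hh)]]
    simp only [groupInd, hmem, true_and, if_true, Nat.add_right_cancel_iff]
    ring
  · have hgr : (N.addEdge m g).groups = insert g N.groups := rfl
    rw [hgr, Finset.sum_insert hmem, hg, hN.groupSize_eq_zero hmem,
      Finset.sum_congr rfl fun h hh => by rw [hne h (ne_of_mem_of_not_mem hh hmem)]]
    simp only [groupInd, hmem, false_and, if_false, zero_add, Nat.right_eq_add]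
    ring

variable (p : Params)

theorem Network.Regular.sum_edges {N : Network} (hN : N.Regular) (f : Node → ℝ) :
    (N.edges.map fun e => f e.2).sum = ∑ g ∈ N.groups, N.groupSize g * f g := by
  have h : N.groups = (N.edges.map Prod.snd).toFinset := by
    ext g
    rw [hN.mem_iff, Multiset.mem_toFinset]
  have h2 : (N.edges.map fun e => f e.2) = (N.edges.map Prod.snd).map f := by
    rw [Multiset.map_map]
    rfl
  rw [h2, Finset.sum_multiset_map_count, h]
  simp only [nsmul_eq_mul, Network.groupSize]

theorem Network.Regular.acceptMean_groupInd {N : Network} (hN : N.Regular) (c C : Color) (k : ℕ) :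
    acceptMean p N c (groupInd N C k) = N.groupCount C k / N.edges.card
      * (p.xi * acceptP p c C * k
        + (1 - p.xi) * acceptU p c C * (N.edges.card / N.groups.card)) := by
  have ht := (card_edges_pos N).ne'
  have hg := (card_groups_pos N).ne'
  have h1 : (N.edges.map fun e => acceptP p c e.2.color * groupInd N C k e.2).sum
      = acceptP p c C * k * N.groupCount C k := by
    rw [hN.sum_edges fun g => acceptP p c g.color * groupInd N C k g, groupCount_eq_sum,
      Finset.mul_sum]
    refine Finset.sum_congr rfl fun g hg => ?_
    by_cases h : g.color = C ∧ N.groupSize g = k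
    · simp only [groupInd, hg, h, and_true, if_true]
      ring
    · simp [groupInd, h]
  have h2 : ∑ g ∈ N.groups, acceptU p c g.color * groupInd N C k g
      = acceptU p c C * N.groupCount C k := by
    rw [groupCount_eq_sum, Finset.mul_sum]
    refine Finset.sum_congr rfl fun g hg => ?_
    by_cases h : g.color = C ∧ N.groupSize g = k
    · simp [groupInd, hg, h]
    · simp [groupInd, h]
  rw [acceptMean, h1, h2]
  field_simp

/-- The rate at which the edges come to the groups of color `C` and size `k`, relative to the
number of these groups divided by the number of edges. -/
def joinRate (N : Network) (C : Color) (k : ℕ) : ℝ :=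
  (1 - p.eta) * (actorProb p N .red * (p.xi * acceptP p .red C * k
      + (1 - p.xi) * acceptU p .red C * (N.edges.card / N.groups.card))
        / roundDen p .red (edgeShare N .red) (groupShare N .red)
    + actorProb p N .blue * (p.xi * acceptP p .blue C * k
      + (1 - p.xi) * acceptU p .blue C * (N.edges.card / N.groups.card))
        / roundDen p .blue (edgeShare N .red) (groupShare N .red))

/-- The number of groups of color `C` and size `k`, divided by the number of edges. -/
def groupDensity (C : Color) (k : ℕ) (N : Network) : ℝ := N.groupCount C k / N.edges.card

theorem expect_stepEdge_groupInd {N : Network} (hN : N.Regular) (C : Color) (k : ℕ) :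
    expect (stepEdge p N) (fun e => groupInd N C k e.2)
      = groupDensity C k N * joinRate p N C k := by
  have h0 : ∀ c, groupInd N C k ⟨N.groups.card, c⟩ = 0 := fun c => by
    simp [groupInd, hN.new_notMem]
  rw [expect_stepEdge p N fun _ g => groupInd N C k g, h0, h0, expect_joinStep, expect_joinStep,
    hN.acceptMean_groupInd, hN.acceptMean_groupInd, acceptMean_one, acceptMean_one, joinRate,
    groupDensity]
  ring

theorem expect_stepEdge_groupInd_mem (N : Network) (C : Color) (k : ℕ) :
    expect (stepEdge p N) (fun e => groupInd N C k e.2) ∈ Set.Icc (0 : ℝ) 1 := by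
  have h : ∀ g, groupInd N C k g ∈ Set.Icc (0 : ℝ) 1 := by
    intro g
    unfold groupInd
    split_ifs <;> simp
  refine ⟨expect_nonneg fun e _ => (h e.2).1, ?_⟩
  rw [← expect_const (finite_support_stepEdge p N) 1]
  exact expect_mono (finite_support_stepEdge p N) fun e _ => (h e.2).2

theorem Network.Regular.groupDensity_mem {N : Network} (hN : N.Regular) (C : Color) (k : ℕ) :
    groupDensity C k N ∈ Set.Icc (0 : ℝ) 1 := by
  refine ⟨by unfold groupDensity; positivity, div_le_one_of_le₀ ?_ (Nat.cast_nonneg _)⟩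
  exact_mod_cast (Finset.card_filter_le _ _).trans hN.card_groups_le

variable (a : ℝ)

/-- The limit of `joinRate`, when `a` is the limiting share of the red group sizes. -/
def limRate (C : Color) (k : ℕ) : ℝ :=
  (1 - p.eta) * (p.r * (p.xi * acceptP p .red C * k
      + (1 - p.xi) * acceptU p .red C * (1 / p.eta)) / denR p a
    + (1 - p.r) * (p.xi * acceptP p .blue C * k
      + (1 - p.xi) * acceptU p .blue C * (1 / p.eta)) / denB p a)

theorem limRate_red (k : ℕ) : limRate p a .red k = CR1 p a * k + CR2 p a := by
  simp only [limRate, CR1, CR2, acceptP, acceptU, reduceCtorEq, if_true, if_false]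
  ring

theorem limRate_blue (k : ℕ) : limRate p a .blue k = CB1 p a * k + CB2 p a := by
  simp only [limRate, CB1, CB2, acceptP, acceptU, reduceCtorEq, if_true, if_false]
  ring

variable {p a}

theorem den_pos (hρ : ∀ c, 0 < p.rhoP c) (ha : IsAlphaStar p a) : 0 < denR p a ∧ 0 < denB p a := by
  have ha' := Set.Ioo_subset_Icc_self ha.1
  rw [← roundDen_red, ← roundDen_blue]
  exact ⟨roundDen_pos hρ _ ha', roundDen_pos hρ _ ha'⟩

theorem tendsto_joinRate (hρ : ∀ c, 0 < p.rhoP c) (ha : IsAlphaStar p a) (C : Color) (k : ℕ) :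
    Tendsto (fun N => joinRate p N C k) (aas p) (𝓝 (limRate p a C k)) := by
  obtain ⟨hR, hB⟩ := den_pos hρ ha
  have hg : Tendsto (fun N => (N.edges.card : ℝ) / N.groups.card) (aas p) (𝓝 (1 / p.eta)) := by
    rw [one_div]
    exact ((tendsto_card_groups p).inv₀ p.eta_mem.1.ne').congr fun N => inv_div _ _
  have hD : ∀ c, Tendsto (fun N => roundDen p c (edgeShare N .red) (groupShare N .red)) (aas p)
      (𝓝 (roundDen p c a p.r)) := by
    intro c
    have hx := tendsto_edgeShare hρ ha
    have hy := tendsto_groupShare p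
    exact (((hx.const_mul _).add ((hx.const_sub 1).const_mul _)).const_mul _).add
      (((hy.const_mul _).add ((hy.const_sub 1).const_mul _)).const_mul _)
  have hDR := hD .red
  have hDB := hD .blue
  rw [roundDen_red] at hDR
  rw [roundDen_blue] at hDB
  exact ((((tendsto_actorProb p .red).mul ((hg.const_mul _).const_add _)).div hDR hR.ne').add
    (((tendsto_actorProb p .blue).mul ((hg.const_mul _).const_add _)).div hDB hB.ne')).const_mul _

theorem limRate_nonneg (hρ : ∀ c, 0 < p.rhoP c) (ha : IsAlphaStar p a) (C : Color) (k : ℕ) :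
    0 ≤ limRate p a C k := by
  obtain ⟨hR, hB⟩ := den_pos hρ ha
  have h1 := p.xi_mem.1
  have h2 := sub_nonneg.2 p.xi_mem.2
  have h3 := p.eta_mem.1
  have h4 := sub_pos.2 p.eta_mem.2
  have h5 := p.r_mem.1
  have h6 := sub_nonneg.2 (r_mem_Icc p).2
  have h7 := fun c => (acceptP_mem p c C).1
  have h8 := fun c => (acceptU_mem p c C).1
  have := h7 .red
  have := h7 .blue
  have := h8 .red
  have := h8 .blue
  unfold limRate
  positivity

theorem limRate_pos (hρ : ∀ c, 0 < p.rhoP c) (ha : IsAlphaStar p a) (C : Color) {k : ℕ}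
    (hk : 1 ≤ k) : 0 < limRate p a C k := by
  obtain ⟨hR, hB⟩ := den_pos hρ ha
  have h1 := p.xi_mem.1
  have h2 := sub_nonneg.2 p.xi_mem.2
  have h3 := p.eta_mem.1
  have h4 := sub_pos.2 p.eta_mem.2
  have h5 := p.r_mem.1
  have h6 : 0 < 1 - p.r := (colorProb_mem p .blue).1
  have hk0 : (1 : ℝ) ≤ k := by exact_mod_cast hk
  have h7 := fun c => (acceptP_mem p c C).1
  have h8 := fun c => (acceptU_mem p c C).1
  have hsame : 0 < p.xi * acceptP p C C * k + (1 - p.xi) * acceptU p C C * (1 / p.eta) := by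
    simp only [acceptP, acceptU, if_true, mul_one]
    rcases h1.eq_or_lt with h0 | h0
    · rw [← h0]
      simpa using h3
    · positivity
  have hoff : ∀ c, 0 ≤ p.xi * acceptP p c C * k + (1 - p.xi) * acceptU p c C * (1 / p.eta) := by
    intro c
    have := h7 c
    have := h8 c
    positivity
  have hR' := hoff .red
  have hB' := hoff .blue
  unfold limRate
  cases C <;> positivity

variable (p a)

/-- The limit of the expected number of groups of color `C` and size `k`, divided by the time. -/
def limGroups (C : Color) : ℕ → ℝ
  | 0 => 0
  | k + 1 => (limRate p a C k * limGroups C k + if k = 0 then p.eta * colorProb p C else 0)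
      / (1 + limRate p a C (k + 1))

variable {p a}

theorem expect_groupDensity_addEdge {N : Network} (hN : N.Regular) (C : Color) (k : ℕ) :
    expect (stepEdge p N) (fun e => groupDensity C (k + 1) (N.addEdge e.1 e.2))
      = (groupDensity C (k + 1) N * N.edges.card
        + (if k = 0 then p.eta * actorProb p N C else 0) + groupDensity C k N * joinRate p N C k
        - groupDensity C (k + 1) N * joinRate p N C (k + 1)) / (N.edges.card + 1) := by
  have hfs := finite_support_stepEdge p N
  have hnew : expect (stepEdge p N)
      (fun e => if e.2 ∈ N.groups then 0 else if e.2.color = C ∧ k = 0 then 1 else 0)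
      = if k = 0 then p.eta * actorProb p N C else 0 := by
    rw [expect_stepEdge_new p hN fun c => if c = C ∧ k = 0 then 1 else 0]
    cases C <;> by_cases hk : k = 0 <;> simp [hk]
  have h1 : ∀ e : Node × Node, groupDensity C (k + 1) (N.addEdge e.1 e.2)
      = 1 / (N.edges.card + 1) * (N.groupCount C (k + 1)
        + (if e.2 ∈ N.groups then 0 else if e.2.color = C ∧ k = 0 then 1 else 0)
        + groupInd N C k e.2 - groupInd N C (k + 1) e.2) := by
    intro e
    rw [groupDensity, hN.groupCount_addEdge]
    simp only [Network.addEdge, Multiset.card_cons]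
    push_cast
    ring
  simp only [h1]
  rw [expect_const_mul, expect_sub hfs, expect_add hfs, expect_add hfs, expect_const hfs, hnew,
    expect_stepEdge_groupInd p hN, expect_stepEdge_groupInd p hN]
  have h2 : groupDensity C (k + 1) N * N.edges.card = N.groupCount C (k + 1) :=
    div_mul_cancel₀ _ (card_edges_pos N).ne'
  rw [h2]
  ring

/-- In expectations, `joinRate` may be replaced by its limit. The rate itself need not be bounded
uniformly in the network, but its product with the density is a probability. -/
theorem tendsto_expect_rate_error (hρ : ∀ c, 0 < p.rhoP c) (ha : IsAlphaStar p a) (C : Color)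
    (k : ℕ) : Tendsto (fun n => expect (law p n) fun N =>
      groupDensity C k N * joinRate p N C k - limRate p a C k * groupDensity C k N) atTop
      (𝓝 0) := by
  have hw := limRate_nonneg hρ ha C k
  refine tendsto_expect p (B := 1 + limRate p a C k) (fun N hN => ?_) ?_
  · obtain ⟨h1, h2⟩ := hN.groupDensity_mem C k
    obtain ⟨h3, h4⟩ := expect_stepEdge_groupInd_mem p N C k
    rw [expect_stepEdge_groupInd p hN] at h3 h4
    have h5 := mul_nonneg hw h1
    have h6 := mul_le_of_le_one_right hw h2
    rw [abs_le]
    constructor <;> linarith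
  · have h := ((tendsto_joinRate hρ ha C k).sub_const (limRate p a C k)).abs
    rw [sub_self, abs_zero] at h
    rw [tendsto_zero_iff_abs_tendsto_zero]
    refine squeeze_zero' (Eventually.of_forall fun N => abs_nonneg _) ?_ h
    filter_upwards [eventually_regular p] with N hN
    obtain ⟨h1, h2⟩ := hN.groupDensity_mem C k
    have h3 : groupDensity C k N * joinRate p N C k - limRate p a C k * groupDensity C k N
        = groupDensity C k N * (joinRate p N C k - limRate p a C k) := by ring
    rw [Function.comp_apply, h3, abs_mul, abs_of_nonneg h1]
    exact mul_le_of_le_one_left (abs_nonneg _) h2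

theorem tendsto_expect_actorProb (C : Color) :
    Tendsto (fun n => expect (law p n) fun N => actorProb p N C - colorProb p C) atTop (𝓝 0) := by
  refine tendsto_expect p (B := 1) (fun N _ => ?_) ?_
  · obtain ⟨h1, h2⟩ := actorProb_mem p N C
    obtain ⟨h3, h4⟩ := colorProb_mem p C
    rw [abs_le]
    constructor <;> linarith
  · have h := (tendsto_actorProb p C).sub_const (colorProb p C)
    rwa [sub_self] at h

theorem tendsto_expect_groupDensity (hρ : ∀ c, 0 < p.rhoP c) (ha : IsAlphaStar p a) (C : Color)
    (k : ℕ) : Tendsto (fun n => expect (law p n) (groupDensity C k)) atTop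
      (𝓝 (limGroups p a C k)) := by
  induction k with
  | zero =>
    refine tendsto_const_nhds.congr fun n => ?_
    rw [limGroups, ← expect_const (finite_support_law p n) 0]
    refine expect_congr fun N hN => ?_
    rw [groupDensity, (law_support p hN).1.groupCount_zero, Nat.cast_zero, zero_div]
  | succ k ih =>
    set L := limGroups p a C (k + 1) with hL
    set w := limRate p a C k
    set w' := limRate p a C (k + 1) with hw'
    set s : ℝ := if k = 0 then 1 else 0 with hs
    have hw0 : 0 ≤ w' := limRate_nonneg hρ ha C (k + 1)
    have hLeq : (1 + w') * L = w * limGroups p a C k + s * (p.eta * colorProb p C) := by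
      rw [hL, limGroups, mul_div_cancel₀ _ (by positivity)]
      by_cases hk : k = 0 <;> simp [hs, hk, w]
    set E1 := fun n => expect (law p n) fun N =>
      groupDensity C k N * joinRate p N C k - w * groupDensity C k N with hE1
    set E2 := fun n => expect (law p n) fun N =>
      groupDensity C (k + 1) N * joinRate p N C (k + 1) - w' * groupDensity C (k + 1) N with hE2
    set E3 := fun n => expect (law p n) fun N => actorProb p N C - colorProb p C with hE3
    have hstep : ∀ n : ℕ, expect (law p (n + 1)) (groupDensity C (k + 1)) - L
        = (1 - (1 + w') / (n + 3)) * (expect (law p n) (groupDensity C (k + 1)) - L)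
          + (w * (expect (law p n) (groupDensity C k) - limGroups p a C k) + E1 n - E2 n
            + s * p.eta * E3 n) / (n + 3) := by
      intro n
      have hfin := finite_support_law p n
      have h3 : (n : ℝ) + 3 ≠ 0 := by positivity
      have h1 : ∀ N ∈ (law p n).support,
          expect (stepEdge p N) (fun e => groupDensity C (k + 1) (N.addEdge e.1 e.2))
          = 1 / (n + 3) * ((n + 2 - w') * groupDensity C (k + 1) N
            + (w * groupDensity C k N
              + ((groupDensity C k N * joinRate p N C k - w * groupDensity C k N)
                - (groupDensity C (k + 1) N * joinRate p N C (k + 1)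
                  - w' * groupDensity C (k + 1) N)
              + (s * p.eta * (actorProb p N C - colorProb p C)
                + s * p.eta * colorProb p C)))) := by
        intro N hN
        obtain ⟨hreg, hcard⟩ := law_support p hN
        have hs' : (if k = 0 then p.eta * actorProb p N C else 0) = s * (p.eta * actorProb p N C) := by
          by_cases hk : k = 0 <;> simp [hs, hk]
        rw [expect_groupDensity_addEdge hreg, hcard, hs']
        push_cast
        have h4 : (n : ℝ) + 2 + 1 = n + 3 := by ring
        rw [h4]
        ring
      rw [expect_law_succ, expect_congr h1, expect_const_mul, expect_add hfin, expect_const_mul,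
        expect_add hfin, expect_const_mul, expect_add hfin, expect_sub hfin, expect_add hfin,
        expect_const_mul, expect_const hfin]
      change 1 / ((n : ℝ) + 3) * ((n + 2 - w') * expect (law p n) (groupDensity C (k + 1))
        + (w * expect (law p n) (groupDensity C k) + (E1 n - E2 n
          + (s * p.eta * E3 n + s * p.eta * colorProb p C)))) - L = _
      -- The constant terms cancel because `L` is the fixed point of the limiting recursion.
      field_simp
      linear_combination -hLeq
    have hv : Tendsto (fun n => |expect (law p n) (groupDensity C (k + 1)) - L|) atTop (𝓝 0) := by
      have herr : Tendsto (fun n => |w * (expect (law p n) (groupDensity C k) - limGroups p a C k)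
          + E1 n - E2 n + s * p.eta * E3 n|) atTop (𝓝 0) := by
        have h := (((((ih.sub_const (limGroups p a C k)).const_mul w).add
          (tendsto_expect_rate_error hρ ha C k)).sub
          (tendsto_expect_rate_error hρ ha C (k + 1))).add
          ((tendsto_expect_actorProb (p := p) C).const_mul (s * p.eta))).abs
        simpa using h
      refine tendsto_zero_of_contraction (c := 1 + w') (by positivity) (fun n => abs_nonneg _) herr ?_
      have hlarge : ∀ᶠ n : ℕ in atTop, 1 + w' ≤ n :=
        tendsto_natCast_atTop_atTop.eventually_ge_atTop _
      filter_upwards [hlarge] with n hn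
      have h3 : (0 : ℝ) < n + 3 := by positivity
      have hq : 0 ≤ 1 - (1 + w') / ((n : ℝ) + 3) := by
        rw [sub_nonneg, div_le_one h3]
        linarith
      rw [hstep n]
      refine (abs_add_le _ _).trans (le_of_eq ?_)
      rw [abs_mul, abs_of_nonneg hq, abs_div, abs_of_pos h3]
    have h := tendsto_zero_iff_abs_tendsto_zero _ |>.2 hv
    simpa using h.add_const L

theorem isLimitGroups_limGroups (hρ : ∀ c, 0 < p.rhoP c) (ha : IsAlphaStar p a) (C : Color)
    (k : ℕ) : IsLimitGroups p C k (limGroups p a C k) := by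
  refine (tendsto_expect_groupDensity hρ ha C k).congr fun n => ?_
  have hfin := finite_support_law p n
  rw [expectedGroups, integral_eq_expect hfin, div_eq_inv_mul, ← expect_const_mul]
  refine expect_congr fun N hN => ?_
  rw [groupDensity, (law_support p hN).2, div_eq_inv_mul]
  push_cast
  rfl

theorem limGroups_pos (hρ : ∀ c, 0 < p.rhoP c) (ha : IsAlphaStar p a) (C : Color) {k : ℕ}
    (hk : 1 ≤ k) : 0 < limGroups p a C k := by
  induction k, hk using Nat.le_induction with
  | base =>
    have h1 := limRate_nonneg hρ ha C 1
    have h2 := p.eta_mem.1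
    have h3 := (colorProb_mem p C).1
    simp only [limGroups, if_true, zero_add, mul_zero]
    positivity
  | succ k hk ih =>
    have h1 := limRate_nonneg hρ ha C (k + 1)
    have h2 := limRate_pos hρ ha C hk
    have hk0 : k ≠ 0 := by omega
    rw [limGroups, if_neg hk0, add_zero]
    positivity

end Master

/-! ### The monotonicity of the ratio -/

section Ratio

variable {p : Params} {a : ℝ}

/-- The ratio increases at `k` exactly if `k < k* - 1`, and decreases exactly if `k* - 1 < k`. -/
theorem ratio_step (hρ : ∀ c, 0 < p.rhoP c) (ha : IsAlphaStar p a) (hC : CR1 p a < CB1 p a)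
    {k : ℕ} (hk : 1 ≤ k) :
    (limGroups p a .red k / limGroups p a .blue k
        < limGroups p a .red (k + 1) / limGroups p a .blue (k + 1) ↔ k < kStar p a - 1)
      ∧ (limGroups p a .red (k + 1) / limGroups p a .blue (k + 1)
        < limGroups p a .red k / limGroups p a .blue k ↔ kStar p a - 1 < k) := by
  have hG := limGroups_pos hρ ha .red hk
  have hH := limGroups_pos hρ ha .blue hk
  have hR := limRate_pos hρ ha .red hk
  have hB := limRate_pos hρ ha .blue hk
  have hR' := limRate_nonneg hρ ha .red (k + 1)
  have hB' := limRate_nonneg hρ ha .blue (k + 1)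
  have hk0 : k ≠ 0 := by omega
  have hr1 : limGroups p a .red (k + 1) / limGroups p a .blue (k + 1)
      = limGroups p a .red k / limGroups p a .blue k
        * ((limRate p a .red k * (1 + limRate p a .blue (k + 1)))
          / (limRate p a .blue k * (1 + limRate p a .red (k + 1)))) := by
    simp only [limGroups, if_neg hk0, add_zero]
    field_simp
  have hu : 0 < limGroups p a .red k / limGroups p a .blue k := div_pos hG hH
  have hden : 0 < limRate p a .blue k * (1 + limRate p a .red (k + 1)) := by positivity
  have hd : 0 < CB1 p a - CR1 p a := sub_pos.2 hC
  have key : limRate p a .red k * (1 + limRate p a .blue (k + 1))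
      - limRate p a .blue k * (1 + limRate p a .red (k + 1))
      = (CB1 p a - CR1 p a) * (kStar p a - 1 - k) := by
    have h1 : kStar p a * (CR1 p a - CB1 p a)
        = (1 + CR1 p a) * (1 + CB2 p a) - (1 + CR2 p a) * (1 + CB1 p a) :=
      div_mul_cancel₀ _ (by linarith)
    simp only [limRate_red, limRate_blue]
    push_cast
    linear_combination h1
  rw [hr1]
  constructor
  · rw [lt_mul_iff_one_lt_right hu, one_lt_div hden, ← sub_pos, key, mul_pos_iff_of_pos_left hd,
      sub_pos]
  · rw [mul_lt_iff_lt_one_right hu, div_lt_one hden, ← sub_neg, key, ← neg_pos,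
      ← mul_neg, mul_pos_iff_of_pos_left hd, neg_pos, sub_neg]

theorem ratio_changesAt (hρ : ∀ c, 0 < p.rhoP c) (ha : IsAlphaStar p a) (hC : CR1 p a < CB1 p a)
    (hk : 2 < kStar p a) : ∃ K : ℕ, IsGreatest {n : ℕ | (n : ℝ) < kStar p a} K ∧
      ChangesAt (fun k => limGroups p a .red k / limGroups p a .blue k) K := by
  have hpos : 0 < ⌈kStar p a⌉₊ := Nat.ceil_pos.2 (by linarith)
  have hmem : ∀ n : ℕ, (n : ℝ) < kStar p a ↔ n ≤ ⌈kStar p a⌉₊ - 1 := fun n => by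
    rw [← Nat.lt_ceil]
    omega
  refine ⟨⌈kStar p a⌉₊ - 1, ⟨(hmem _).2 le_rfl, fun n hn => (hmem n).1 hn⟩, ?_⟩
  set K := ⌈kStar p a⌉₊ - 1
  have hK2 : 2 ≤ K := (hmem 2).1 (by exact_mod_cast hk)
  have hK : kStar p a - 1 ≤ K := by
    have h := mt (hmem (K + 1)).1 (by omega)
    push_cast at h
    linarith
  refine ⟨hK2, fun k hk1 hkK => ?_, ?_, fun k hkK => ?_⟩
  · refine (ratio_step hρ ha hC hk1).1.2 ?_
    have h := (hmem (k + 1)).2 (by omega)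
    push_cast at h
    linarith
  · have h := mt (ratio_step hρ ha hC (show 1 ≤ K by omega)).1.1 (not_lt.2 hK)
    exact not_lt.1 h
  · refine (ratio_step hρ ha hC (show 1 ≤ k by omega)).2.2 (hK.trans_lt ?_)
    exact_mod_cast hkK

end Ratio

end GSHM

end

theorem theorem5p3 (p : GSHM.Params)
    (hR : 0 < p.rhoP GSHM.Color.red) (hB : 0 < p.rhoP GSHM.Color.blue) :
    (∃! a : ℝ, GSHM.IsAlphaStar p a) ∧
    ∀ a : ℝ, GSHM.IsAlphaStar p a → GSHM.CR1 p a < GSHM.CB1 p a →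
      ∃ G : GSHM.Color → ℕ → ℝ,
        (∀ c k, 1 ≤ k → GSHM.IsLimitGroups p c k (G c k)) ∧
        (∀ c k, 1 ≤ k → 0 < G c k) ∧
        (GSHM.HasChasm (fun k => G GSHM.Color.red k / G GSHM.Color.blue k) ↔
          2 < GSHM.kStar p a) ∧
        (2 < GSHM.kStar p a →
          ∃ K : ℕ, IsGreatest {n : ℕ | (n : ℝ) < GSHM.kStar p a} K ∧
            GSHM.ChangesAt (fun k => G GSHM.Color.red k / G GSHM.Color.blue k) K) := by
  have hρ : ∀ c, 0 < p.rhoP c := fun c => by cases c <;> assumption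
  refine ⟨GSHM.existsUnique_alphaStar hρ, fun a ha hC => ⟨GSHM.limGroups p a,
    fun c k _ => GSHM.isLimitGroups_limGroups hρ ha c k, fun c k hk => GSHM.limGroups_pos hρ ha c hk,
    ⟨?_, ?_⟩, GSHM.ratio_changesAt hρ ha hC⟩⟩
  · rintro ⟨K, hK2, hinc, -⟩
    have h := (GSHM.ratio_step hρ ha hC le_rfl).1.1 (hinc 1 le_rfl (by omega))
    push_cast at h
    linarith
  · intro hk
    obtain ⟨K, -, hK⟩ := GSHM.ratio_changesAt hρ ha hC hk
    exact ⟨K, hK⟩
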